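/- Let $\tau$ be a point of the upper half-plane and write $q^x=\exp(2\pi i x\tau)$ for $x\in\mathbb{Q}$. Let $$\eta(\tau)=q^{1/24}\prod_{n\ge 1}(1-q^n),\qquad \theta_c(z,\tau)=\sum_{n\in\mathbb{Z}+c}\exp(\pi i\tau n^2+2\pi i nz)\quad(c\in\mathbb{Q}),\qquad \theta=\theta_0,$$ and for $S\subset\mathbb{Q}^2$ put $$\sum_{(m,n)\in S}^{\mathrm{indef}}a_{m,n}=\sum_{(m,n)\in S,\ m\ge 0,\ n\ge 0}a_{m,n}-\sum_{(m,n)\in S,\ m<0,\ n<0}a_{m,n}.$$ Then all sums and products below converge absolutely, the denominators below do not vanish, and the following identities hold: $$q^{\frac1{12}}\sum_{(m,n)\in\mathbb{Z}^2}^{\mathrm{indef}}(-1)^{m+n}q^{2mn+\frac{m^2+m}{2}+\frac{n^2+n}{2}}=\eta(\tau)^2,\tag{1}$$ $$\sum_{(m,n)\in\mathbb{Z}^2,\ m\equiv n+1\,(2)}^{\mathrm{indef}}(-1)^{\frac{m+n-1}{2}}q^{\frac{m^2+6mn+3n^2}{2}}=\frac{\eta(2\tau)^3\,\theta_{\frac12}(\frac14,3\tau)}{\theta(\frac12,4\tau)\,\theta_{\frac12}(\frac14,\tau)}=q^{\frac12}\prod_{n\ge1}(1+q^n)(1-q^{2n})(1-q^{3n})(1+q^{6n}),\tag{2}$$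 $$\sum_{m\in\mathbb{Z}+\frac12,\ n\in\mathbb{Z}}^{\mathrm{indef}}(-1)^{m+n-\frac12}q^{\frac{m^2+6mn+3n^2}{2}}=\frac{\eta(2\tau)^3\,\theta(\frac14,3\tau)}{\theta_{\frac14}(0,4\tau)\,\theta(\frac14,\tau)}=q^{\frac18}\prod_{n\ge1}(1-q^n)(1+q^{2n})(1-q^{3n})(1+q^{6n-3}),\tag{3}$$ $$\sum_{m\in\mathbb{Z},\ n\in\mathbb{Z}+\frac12}^{\mathrm{indef}}(-1)^{m+n-\frac12}q^{\frac{m^2+6mn+3n^2}{2}}=\frac{\eta(2\tau)^3\,\theta_{\frac12}(\frac14,3\tau)}{\theta_{\frac14}(0,4\tau)\,\theta_{\frac12}(\frac14,\tau)}=q^{\frac38}\prod_{n\ge1}(1-q^n)(1+q^{2n-1})(1-q^{3n})(1+q^{6n}).\tag{4}$$ -/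

import Mathlib

open Complex
open scoped Real UpperHalfPlane

noncomputable section

/-- `q ^ x = exp (2 π i x τ)` for a rational exponent `x`, where `q = exp (2 π i τ)`. -/
def qPow (τ : ℍ) (x : ℚ) : ℂ :=
  cexp (2 * π * I * (x : ℂ) * (τ : ℂ))

/-- `θ_c(z, τ) = ∑_{n ∈ ℤ + c} exp (π i τ n² + 2 π i n z)`; the usual `θ` is the case `c = 0`. -/
def thetaChar (c : ℚ) (z τ : ℂ) : ℂ :=
  ∑' n : ℤ, cexp (π * I * τ * ((n : ℂ) + (c : ℂ)) ^ 2 + 2 * π * I * ((n : ℂ) + (c : ℂ)) * z)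

/-- The series defining `θ_c(z, τ)` converges absolutely when `τ` lies in the upper half-plane. -/
theorem summable_thetaChar (c : ℚ) (z : ℂ) {τ : ℂ} (hτ : 0 < τ.im) :
    Summable fun n : ℤ =>
      cexp (π * I * τ * ((n : ℂ) + (c : ℂ)) ^ 2 + 2 * π * I * ((n : ℂ) + (c : ℂ)) * z) := by
  have h := ((summable_jacobiTheta₂_term_iff (z + (c : ℂ) * τ) τ).mpr hτ).mul_left
    (cexp (π * I * τ * (c : ℂ) ^ 2 + 2 * π * I * (c : ℂ) * z))
  refine h.congr fun n => ?_
  rw [jacobiTheta₂_term, ← Complex.exp_add]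
  congr 1
  ring

/-- The points of `S` with both coordinates nonnegative. -/
def posPart (S : Set (ℚ × ℚ)) : Set (ℚ × ℚ) :=
  {x | x ∈ S ∧ 0 ≤ x.1 ∧ 0 ≤ x.2}

/-- The points of `S` with both coordinates negative. -/
def negPart (S : Set (ℚ × ℚ)) : Set (ℚ × ℚ) :=
  {x | x ∈ S ∧ x.1 < 0 ∧ x.2 < 0}

/-- The two series that make up the indefinite sum converge absolutely. -/
def IndefSummable (S : Set (ℚ × ℚ)) (a : ℚ → ℚ → ℂ) : Prop :=
  (Summable fun x : posPart S => a x.1.1 x.1.2) ∧ (Summable fun x : negPart S => a x.1.1 x.1.2)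

/-- `∑^{indef}_{(m,n) ∈ S} a_{m,n} =
  ∑_{(m,n) ∈ S, m ≥ 0, n ≥ 0} a_{m,n} - ∑_{(m,n) ∈ S, m < 0, n < 0} a_{m,n}`. -/
def indefSum (S : Set (ℚ × ℚ)) (a : ℚ → ℚ → ℂ) : ℂ :=
  (∑' x : posPart S, a x.1.1 x.1.2) - ∑' x : negPart S, a x.1.1 x.1.2

/-- The lattice `ℤ²`. -/
def latticeZZ : Set (ℚ × ℚ) :=
  {x | ∃ i j : ℤ, x = ((i : ℚ), (j : ℚ))}

/-- The pairs of integers `(m, n)` with `m ≡ n + 1 (mod 2)`. -/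
def latticeOdd : Set (ℚ × ℚ) :=
  {x | ∃ i j : ℤ, i ≡ j + 1 [ZMOD 2] ∧ x = ((i : ℚ), (j : ℚ))}

/-- The pairs `(m, n)` with `m ∈ ℤ + 1/2` and `n ∈ ℤ`. -/
def latticeHalfLeft : Set (ℚ × ℚ) :=
  {x | ∃ i j : ℤ, x = ((i : ℚ) + 1 / 2, (j : ℚ))}

/-- The pairs `(m, n)` with `m ∈ ℤ` and `n ∈ ℤ + 1/2`. -/
def latticeHalfRight : Set (ℚ × ℚ) :=
  {x | ∃ i j : ℤ, x = ((i : ℚ), (j : ℚ) + 1 / 2)}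

/-- `(-1) ^ x`, as the principal complex power; it is used only where `x` is an integer. -/
def negOnePow (x : ℚ) : ℂ :=
  (-1 : ℂ) ^ (x : ℂ)

/-- For integers, `negOnePow` is the usual integer power of `-1`. -/
theorem negOnePow_intCast (k : ℤ) : negOnePow (k : ℚ) = (-1 : ℂ) ^ k := by
  rw [negOnePow, Rat.cast_intCast, Complex.cpow_intCast]

end

/-! The sums are evaluated by the coefficient extraction in `intIndefSum_convolution`. Put T(k) =
(-1)^k Q^(k(k+1)/2) and Θ_Q(z) = ∑ T(k) z^k; by the Jacobi triple product, Θ_Q vanishes exactly at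
the integer powers of Q. Consider an indefinite sum of T(n) Q^(nm) v(m), where V(z) = ∑ v(m) z^m is
divisible by Θ_Q: V = Θ_Q R with R = ∑ r(N) z^N. Then v(m) = ∑ T(m-N) r(N), and completing the
square gives T(n) Q^(nm) T(m-N) = (-1)^N Q^(N(N-1)/2) T(m+n) Q^(-Nm).

So everything reduces to S(x) = ∑^indef T(m+n) x^m at x = Q^(-N). Summing along the diagonals m+n =
k turns S(x) into the one-dimensional series of T(k) (1 - x^(k+1))/(1 - x). For x = Q^(-N) with N ≠
0 this is a combination of two theta values at powers of Q, hence zero; for x = 1 it is ∑ (k+1) T(k)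
= (Q;Q)_∞^3, Jacobi's cube identity. Only N = 0 survives, and the indefinite sum equals r(0)
(Q;Q)_∞^3.

What remains is to factor V and find the constant term r(0). For the form (m² + 6mn + 3n²)/2 take Q
= q³ and V(z) = Θ_q(q^s z): sorting the factors mod 3 gives Θ_Q(z) times two further theta
functions, and the constant term of a product of two theta functions is again a theta series. The
sum over m ≡ n+1 (mod 2) consists of two such sums in base q⁴, which are the even and odd halves of
one theta series. For the first identity Q = q and V(z) = Θ_q(z²), and the constant term is Euler's
pentagonal series. The right-hand sides are matched by expanding η and θ as products and comparing
by elementary splittings. -/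

section

open Filter Topology Finset

/-! ### Infinite products and their splittings -/

/-- The infinite `q`-Pochhammer symbol `(x; q)_∞ = ∏_{n ≥ 0} (1 - x q ^ n)`. -/
noncomputable def qPoch (x q : ℂ) : ℂ := ∏' n : ℕ, (1 - x * q ^ n)

theorem summable_norm_qPoch (x : ℂ) {q : ℂ} (hq : ‖q‖ < 1) :
    Summable fun n : ℕ => ‖-(x * q ^ n)‖ := by
  simpa using (summable_geometric_of_lt_one (norm_nonneg q) hq).mul_left ‖x‖

theorem multipliable_qPoch (x : ℂ) {q : ℂ} (hq : ‖q‖ < 1) :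
    Multipliable fun n : ℕ => 1 - x * q ^ n := by
  simpa [sub_eq_add_neg] using multipliable_one_add_of_summable (summable_norm_qPoch x hq)

theorem tendsto_qPoch (x : ℂ) {q : ℂ} (hq : ‖q‖ < 1) :
    Tendsto (fun N => ∏ n ∈ range N, (1 - x * q ^ n)) atTop (𝓝 (qPoch x q)) :=
  (multipliable_qPoch x hq).hasProd.tendsto_prod_nat

theorem qPoch_ne_zero {x q : ℂ} (hq : ‖q‖ < 1) (h : ∀ n : ℕ, x * q ^ n ≠ 1) : qPoch x q ≠ 0 := by
  have := tprod_one_add_ne_zero_of_summable (f := fun n : ℕ => -(x * q ^ n))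
    (fun n => by rw [← sub_eq_add_neg]; exact sub_ne_zero.mpr (h n).symm)
    (summable_norm_qPoch x hq)
  simpa [qPoch, sub_eq_add_neg] using this

theorem qPoch_ne_zero_of_norm_lt {x q : ℂ} (hq : ‖q‖ < 1) (hx : ‖x‖ < 1) : qPoch x q ≠ 0 := by
  refine qPoch_ne_zero hq fun n h => ?_
  have h1 : ‖x * q ^ n‖ < 1 := by
    rw [norm_mul, norm_pow]
    calc ‖x‖ * ‖q‖ ^ n ≤ ‖x‖ * 1 := by
          gcongr; exact pow_le_one₀ (norm_nonneg _) hq.le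
      _ < 1 := by simpa
  rw [h] at h1
  simp at h1

theorem norm_pow_lt_one {q : ℂ} (hq : ‖q‖ < 1) {m : ℕ} (hm : m ≠ 0) : ‖q ^ m‖ < 1 := by
  rw [norm_pow]
  exact pow_lt_one₀ (norm_nonneg _) hq hm

theorem qPoch_eq_one_sub_mul (x : ℂ) {q : ℂ} (hq : ‖q‖ < 1) :
    qPoch x q = (1 - x) * qPoch (x * q) q := by
  refine tendsto_nhds_unique ((tendsto_qPoch x hq).comp (tendsto_add_atTop_nat 1)) ?_
  refine ((tendsto_qPoch (x * q) hq).const_mul (1 - x)).congr fun N => ?_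
  simp only [Function.comp, prod_range_succ', pow_zero, mul_one]
  rw [mul_comm]
  congr 1
  exact prod_congr rfl fun n _ => by ring

theorem qPoch_mul_qPoch_neg (x : ℂ) {q : ℂ} (hq : ‖q‖ < 1) :
    qPoch x q * qPoch (-x) q = qPoch (x ^ 2) (q ^ 2) := by
  refine tendsto_nhds_unique ((tendsto_qPoch x hq).mul (tendsto_qPoch (-x) hq)) ?_
  refine (tendsto_qPoch (x ^ 2) (norm_pow_lt_one hq two_ne_zero)).congr fun N => ?_
  rw [← prod_mul_distrib]
  exact prod_congr rfl fun n _ => by ring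

/-- Factors are sorted by the parity of the index; along the first 2N factors the splitting is
already exact, so it passes to the limit. -/
theorem qPoch_split_two (x : ℂ) {q : ℂ} (hq : ‖q‖ < 1) :
    qPoch x q = qPoch x (q ^ 2) * qPoch (x * q) (q ^ 2) := by
  have h2 := norm_pow_lt_one hq two_ne_zero
  refine tendsto_nhds_unique ((tendsto_qPoch x hq).comp
    (tendsto_id.nsmul_atTop (two_pos : 0 < 2))) ?_
  refine ((tendsto_qPoch x h2).mul (tendsto_qPoch (x * q) h2)).congr fun N => ?_
  simp only [Function.comp, id, smul_eq_mul]
  induction N with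
  | zero => simp
  | succ n ih =>
    rw [show 2 * (n + 1) = 2 * n + 1 + 1 by ring]
    simp only [prod_range_succ]
    rw [← ih]
    ring

theorem qPoch_split_three (x : ℂ) {q : ℂ} (hq : ‖q‖ < 1) :
    qPoch x q = qPoch x (q ^ 3) * qPoch (x * q) (q ^ 3) * qPoch (x * q ^ 2) (q ^ 3) := by
  have h3 := norm_pow_lt_one hq three_ne_zero
  refine tendsto_nhds_unique ((tendsto_qPoch x hq).comp
    (tendsto_id.nsmul_atTop (three_pos : 0 < 3))) ?_
  refine (((tendsto_qPoch x h3).mul (tendsto_qPoch (x * q) h3)).mul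
    (tendsto_qPoch (x * q ^ 2) h3)).congr fun N => ?_
  simp only [Function.comp, id, smul_eq_mul]
  induction N with
  | zero => simp
  | succ n ih =>
    rw [show 3 * (n + 1) = 3 * n + 1 + 1 + 1 by ring]
    simp only [prod_range_succ]
    rw [← ih]
    ring

/-! ### Triangular exponents and convergence of theta series -/

/-- The exponent `k (k - 1) / 2`. -/
def tri (k : ℤ) : ℤ := k * (k - 1) / 2

theorem two_mul_tri (k : ℤ) : 2 * tri k = k * (k - 1) :=
  Int.mul_ediv_cancel' (Int.even_mul_pred_self k).two_dvd

theorem tri_natCast (k : ℕ) : tri k = (k.choose 2 : ℕ) := by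
  have h := two_mul_tri k
  have h2 : ((k.choose 2 : ℕ) : ℚ) = k * (k - 1) / 2 := Nat.cast_choose_two ℚ k
  have : ((tri k : ℤ) : ℚ) = ((k.choose 2 : ℕ) : ℚ) := by
    rw [h2]
    have : (2 : ℚ) * (tri k : ℤ) = k * (k - 1) := by exact_mod_cast h
    linarith
  exact_mod_cast this

theorem tri_add_one (k : ℤ) : tri (k + 1) = tri k + k := by
  have h1 := two_mul_tri (k + 1)
  have h2 := two_mul_tri k
  linarith

theorem tri_one_sub (k : ℤ) : tri (1 - k) = tri k := by
  have h1 := two_mul_tri (1 - k)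
  have h2 := two_mul_tri k
  linarith

theorem summable_nat_pow_tri {t : ℝ} (ht0 : 0 < t) (ht : t < 1) {r : ℝ} (hr : 0 < r) :
    Summable fun n : ℕ => t ^ tri n * r ^ (n : ℤ) := by
  refine summable_of_ratio_test_tendsto_lt_one (l := 0) zero_lt_one
    (Eventually.of_forall fun n => by positivity) ?_
  -- The ratio of consecutive terms is t^n r.
  have : Tendsto (fun n : ℕ => t ^ n * r) atTop (𝓝 (0 * r)) :=
    (tendsto_pow_atTop_nhds_zero_of_lt_one ht0.le ht).mul_const r
  rw [zero_mul] at this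
  refine this.congr fun n => ?_
  rw [Real.norm_of_nonneg (by positivity), Real.norm_of_nonneg (by positivity)]
  push_cast
  rw [tri_add_one, zpow_add₀ ht0.ne', zpow_add₀ hr.ne']
  have h1 : t ^ tri n ≠ 0 := (zpow_pos ht0 _).ne'
  have h2 : r ^ (n : ℤ) ≠ 0 := (zpow_pos hr _).ne'
  rw [zpow_natCast, zpow_one]
  rw [eq_div_iff (mul_ne_zero h1 h2)]
  ring

theorem summable_pow_tri {t : ℝ} (ht0 : 0 < t) (ht : t < 1) {r : ℝ} (hr : 0 < r) :
    Summable fun k : ℤ => t ^ tri k * r ^ k := by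
  refine Summable.of_nat_of_neg_add_one (summable_nat_pow_tri ht0 ht hr) ?_
  have h := (summable_nat_add_iff 2).mpr (summable_nat_pow_tri ht0 ht (inv_pos.mpr hr))
  refine (h.mul_left r).congr fun n => ?_
  -- The symmetry k ↦ 1 - k of the exponent turns the negative half into a shifted positive half
  -- with r inverted.
  have e : tri (-((n : ℤ) + 1)) = tri ((n + 2 : ℕ) : ℤ) := by
    rw [← tri_one_sub]; congr 1; push_cast; ring
  rw [e, inv_zpow, ← zpow_neg, mul_left_comm]
  congr 1
  rw [← zpow_one_add₀ hr.ne']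
  push_cast
  ring_nf

theorem summable_abs_mul_pow_tri {t : ℝ} (ht0 : 0 < t) (ht : t < 1) {r : ℝ} (hr : 0 < r) :
    Summable fun k : ℤ => |(k : ℝ)| * (t ^ tri k * r ^ k) := by
  refine Summable.of_nonneg_of_le (fun k => by positivity) (fun k => ?_)
    ((summable_pow_tri ht0 ht (mul_pos two_pos hr)).add
      (summable_pow_tri ht0 ht (mul_pos (inv_pos.mpr two_pos) hr)))
  -- The linear factor is absorbed by changing r to 2r and r/2.
  have key : |(k : ℝ)| ≤ 2 ^ k + 2⁻¹ ^ k := by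
    have hn (n : ℕ) : (n : ℝ) ≤ 2 ^ n := by exact_mod_cast Nat.lt_two_pow_self.le
    rcases Int.eq_nat_or_neg k with ⟨n, rfl | rfl⟩
    · have := hn n
      have h2 : (0 : ℝ) ≤ 2⁻¹ ^ (n : ℤ) := by positivity
      simp only [Int.cast_natCast, Nat.abs_cast, zpow_natCast] at *
      linarith
    · have := hn n
      have h2 : (0 : ℝ) ≤ 2 ^ (-(n : ℤ)) := by positivity
      simp only [Int.cast_neg, abs_neg, Int.cast_natCast, Nat.abs_cast, inv_zpow', neg_neg,
        zpow_natCast] at *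
      linarith
  rw [mul_zpow, mul_zpow]
  have : (0 : ℝ) ≤ t ^ tri k * r ^ k := by positivity
  nlinarith [mul_le_mul_of_nonneg_right key this]

/-! ### Gaussian binomials, the triple product and Jacobi's cube -/

/-- The `k`-th coefficient of `(q; q)_∞ (z; q)_∞ (q / z; q)_∞` as a Laurent series in `z`. -/
noncomputable def thetaCoeff (q : ℂ) (k : ℤ) : ℂ := (-1) ^ k * q ^ tri k

theorem norm_thetaCoeff (q : ℂ) (k : ℤ) : ‖thetaCoeff q k‖ = ‖q‖ ^ tri k := by
  simp [thetaCoeff, norm_zpow]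

theorem summable_norm_thetaCoeff {q : ℂ} (hq0 : q ≠ 0) (hq : ‖q‖ < 1) {z : ℂ} (hz : z ≠ 0) :
    Summable fun k => ‖thetaCoeff q k * z ^ k‖ := by
  simpa [norm_thetaCoeff, norm_zpow] using
    summable_pow_tri (norm_pos_iff.mpr hq0) hq (norm_pos_iff.mpr hz)

/-- The finite product `(q; q)_n`. -/
noncomputable def qFact (q : ℂ) (n : ℕ) : ℂ := ∏ i ∈ range n, (1 - q * q ^ i)

theorem qFact_succ (q : ℂ) (n : ℕ) : qFact q (n + 1) = qFact q n * (1 - q ^ (n + 1)) := by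
  rw [qFact, prod_range_succ, ← qFact, pow_succ']

theorem qFact_ne_zero {q : ℂ} (hq : ‖q‖ < 1) (n : ℕ) : qFact q n ≠ 0 := by
  refine prod_ne_zero_iff.mpr fun i _ h => ?_
  have h1 := norm_pow_lt_one hq i.succ_ne_zero
  rw [pow_succ', ← sub_eq_zero.mp h] at h1
  simp at h1

/-- The Gaussian binomial coefficient. -/
noncomputable def gaussBinom (q : ℂ) (N k : ℕ) : ℂ :=
  if k ≤ N then qFact q N / (qFact q k * qFact q (N - k)) else 0

theorem gaussBinom_zero_right {q : ℂ} (hq : ‖q‖ < 1) (N : ℕ) : gaussBinom q N 0 = 1 := by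
  rw [gaussBinom, if_pos N.zero_le, Nat.sub_zero, show qFact q 0 = 1 by simp [qFact], one_mul,
    div_self (qFact_ne_zero hq N)]

theorem gaussBinom_self {q : ℂ} (hq : ‖q‖ < 1) (N : ℕ) : gaussBinom q N N = 1 := by
  rw [gaussBinom, if_pos le_rfl, Nat.sub_self, show qFact q 0 = 1 by simp [qFact], mul_one,
    div_self (qFact_ne_zero hq N)]

theorem gaussBinom_succ_succ {q : ℂ} (hq : ‖q‖ < 1) {N k : ℕ} (hk : k ≤ N) :
    gaussBinom q (N + 1) (k + 1) = gaussBinom q N (k + 1) + q ^ (N - k) * gaussBinom q N k := by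
  obtain ⟨d, rfl⟩ := Nat.exists_eq_add_of_le hk
  -- For k = N the term `gaussBinom q N (k + 1)` is 0 by convention, so the quotient formula does
  -- not apply to it.
  rcases d with _ | d
  · rw [add_zero, gaussBinom_self hq, gaussBinom_self hq]
    simp [gaussBinom]
  · have h1 := qFact_ne_zero hq (k + (d + 1))
    have h2 := qFact_ne_zero hq k
    have h3 := qFact_ne_zero hq d
    have h4 := qFact_ne_zero hq (k + 1)
    have h5 := qFact_ne_zero hq (d + 1)
    rw [gaussBinom, gaussBinom, gaussBinom, if_pos (by omega), if_pos (by omega),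
      if_pos (by omega), show k + (d + 1) + 1 - (k + 1) = d + 1 by omega,
      show k + (d + 1) - (k + 1) = d by omega, show k + (d + 1) - k = d + 1 by omega,
      qFact_succ q (k + (d + 1))]
    rw [qFact_succ] at h4 h5
    rw [qFact_succ q k, qFact_succ q d]
    have h6 := right_ne_zero_of_mul h4
    have h7 := right_ne_zero_of_mul h5
    field_simp
    ring

/-- The q-binomial theorem, by induction on N from the q-Pascal rule. -/
theorem prod_one_add_mul_pow {q : ℂ} (hq : ‖q‖ < 1) (z : ℂ) (N : ℕ) :
    ∏ k ∈ range N, (1 + z * q ^ k) =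
      ∑ k ∈ range (N + 1), gaussBinom q N k * (q ^ k.choose 2 * z ^ k) := by
  induction N with
  | zero => simp [gaussBinom_self hq]
  | succ N ih =>
    have e0 : ∑ k ∈ range (N + 1),
          gaussBinom q (N + 1) (k + 1) * (q ^ (k + 1).choose 2 * z ^ (k + 1)) =
        ∑ k ∈ range (N + 1), (gaussBinom q N (k + 1) * (q ^ (k + 1).choose 2 * z ^ (k + 1)) +
          q ^ (N - k) * gaussBinom q N k * (q ^ (k + 1).choose 2 * z ^ (k + 1))) :=
      sum_congr rfl fun k hk => by
        rw [gaussBinom_succ_succ hq (Nat.lt_succ_iff.mp (mem_range.mp hk)), add_mul]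
    rw [prod_range_succ, ih, sum_range_succ' _ (N + 1), e0, sum_add_distrib, mul_add, mul_one,
      gaussBinom_zero_right hq]
    have e1 : ∑ k ∈ range (N + 1), gaussBinom q N k * (q ^ k.choose 2 * z ^ k) =
        ∑ k ∈ range (N + 1), gaussBinom q N (k + 1) * (q ^ (k + 1).choose 2 * z ^ (k + 1)) +
          1 * (q ^ Nat.choose 0 2 * z ^ 0) := by
      rw [← gaussBinom_zero_right hq N,
        ← sum_range_succ' (fun k => gaussBinom q N k * (q ^ k.choose 2 * z ^ k)),
        sum_range_succ _ (N + 1)]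
      simp [gaussBinom]
    have e2 : (∑ k ∈ range (N + 1), gaussBinom q N k * (q ^ k.choose 2 * z ^ k)) * (z * q ^ N) =
        ∑ k ∈ range (N + 1),
          q ^ (N - k) * gaussBinom q N k * (q ^ (k + 1).choose 2 * z ^ (k + 1)) := by
      rw [sum_mul]
      refine sum_congr rfl fun k hk => ?_
      have hk' : k ≤ N := Nat.lt_succ_iff.mp (mem_range.mp hk)
      have : (k + 1).choose 2 = k + k.choose 2 := by
        rw [Nat.choose_succ_succ' k 1, Nat.choose_one_right]
      rw [this]
      have e3 : q ^ N = q ^ (N - k) * q ^ k := by rw [← pow_add, Nat.sub_add_cancel hk']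
      rw [e3]
      ring
    rw [e2, e1]
    ring

/-- Each factor is turned around by 1 - z q^(-j) = -z q^(-j) (1 - q^j / z), and 1 + ... + n = `tri
(n + 1)`. -/
theorem prod_one_sub_mul_zpow_neg {q : ℂ} (hq0 : q ≠ 0) {z : ℂ} (hz : z ≠ 0) (n : ℕ) :
    ∏ i ∈ range n, (1 - z * q ^ (-((i : ℤ) + 1))) =
      (-z) ^ n * q ^ (-tri (n + 1)) * ∏ i ∈ range n, (1 - q / z * q ^ i) := by
  induction n with
  | zero => simp [tri]
  | succ n ih =>
    rw [prod_range_succ, prod_range_succ, ih]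
    rw [Nat.cast_succ, tri_add_one (n + 1), neg_add (tri (n + 1)), zpow_add₀ hq0 (-tri (n + 1)),
      zpow_neg q ((n : ℤ) + 1),
      zpow_add_one₀ hq0, zpow_natCast]
    have := pow_ne_zero n hq0
    field_simp
    ring

theorem finite_jacobi_triple_product {q : ℂ} (hq0 : q ≠ 0) (hq : ‖q‖ < 1) {z : ℂ} (hz : z ≠ 0)
    (n : ℕ) :
    (∏ i ∈ range n, (1 - z * q ^ i)) * ∏ i ∈ range n, (1 - q / z * q ^ i) =
      ∑ k ∈ range (2 * n + 1), gaussBinom q (2 * n) k *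
        (thetaCoeff q ((k : ℤ) - n) * z ^ ((k : ℤ) - n)) := by
  have hzn : (-z) ^ n ≠ 0 := pow_ne_zero _ (neg_ne_zero.mpr hz)
  have hqn : q ^ (-tri (n + 1)) ≠ 0 := zpow_ne_zero _ hq0
  -- Centring the 2n factors: the exponents of q now run from -n to n-1, the negative ones giving
  -- the product in q/z.
  have h := prod_one_add_mul_pow hq (-z * q ^ (-(n : ℤ))) (2 * n)
  rw [two_mul n, prod_range_add] at h
  have h1 : ∏ i ∈ range n, (1 + -z * q ^ (-(n : ℤ)) * q ^ i) =
      ∏ i ∈ range n, (1 - z * q ^ (-((i : ℤ) + 1))) := by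
    rw [← prod_range_reflect]
    refine prod_congr rfl fun i hi => ?_
    have hi' := mem_range.mp hi
    rw [mul_assoc, ← zpow_natCast, ← zpow_add₀ hq0, neg_mul, ← sub_eq_add_neg]
    congr 3
    push_cast [Nat.cast_sub (show 1 ≤ n by omega), Nat.cast_sub (show i ≤ n - 1 by omega)]
    ring
  have h2 : ∏ i ∈ range n, (1 + -z * q ^ (-(n : ℤ)) * q ^ (n + i)) =
      ∏ i ∈ range n, (1 - z * q ^ i) := by
    refine prod_congr rfl fun i _ => ?_
    rw [mul_assoc, ← zpow_natCast, ← zpow_add₀ hq0, neg_mul, ← sub_eq_add_neg, ← zpow_natCast]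
    congr 3
    push_cast
    ring
  rw [h1, h2, prod_one_sub_mul_zpow_neg hq0 hz] at h
  refine mul_left_cancel₀ (mul_ne_zero hzn hqn) ?_
  rw [two_mul n, mul_sum]
  refine Eq.trans (by ring) (h.trans (sum_congr rfl fun k _ => ?_))
  have hz' : (-z) ^ (n : ℤ) * (-z) ^ ((k : ℤ) - n) = (-z) ^ k := by
    rw [← zpow_add₀ (neg_ne_zero.mpr hz), ← zpow_natCast]; congr 1; ring
  have hs : (-1 : ℂ) ^ ((k : ℤ) - n) * z ^ ((k : ℤ) - n) = (-z) ^ ((k : ℤ) - n) := by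
    rw [← mul_zpow]; simp
  have he : q ^ (-tri (n + 1)) * q ^ tri ((k : ℤ) - n) = q ^ k.choose 2 * q ^ (-(n : ℤ) * k) := by
    rw [← zpow_natCast q (k.choose 2), ← tri_natCast, ← zpow_add₀ hq0, ← zpow_add₀ hq0]
    congr 1
    have a1 := two_mul_tri (n + 1)
    have a2 := two_mul_tri ((k : ℤ) - n)
    have a3 := two_mul_tri k
    linarith
  rw [mul_pow, ← zpow_natCast (q ^ (-(n : ℤ))), ← zpow_mul, thetaCoeff, ← hz', ← hs,
    ← zpow_natCast (-z) n]
  linear_combination (-(gaussBinom q (n + n) k * ((-z) ^ (n : ℤ) * ((-1 : ℂ) ^ ((k : ℤ) - n) *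
    z ^ ((k : ℤ) - n))))) * he

theorem tendsto_qFact {q : ℂ} (hq : ‖q‖ < 1) : Tendsto (qFact q) atTop (𝓝 (qPoch q q)) :=
  tendsto_qPoch q hq

/-- The finite products (q;q)_n converge to a nonzero limit, so they and their inverses are bounded.
-/
theorem exists_norm_gaussBinom_le {q : ℂ} (hq : ‖q‖ < 1) :
    ∃ C, ∀ N k, ‖gaussBinom q N k‖ ≤ C := by
  have hE := qPoch_ne_zero_of_norm_lt hq hq
  obtain ⟨A, hA⟩ := (tendsto_qFact hq).norm.bddAbove_range
  obtain ⟨B, hB⟩ := ((tendsto_qFact hq).inv₀ hE).norm.bddAbove_range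
  have hA' (n : ℕ) : ‖qFact q n‖ ≤ A := hA ⟨n, rfl⟩
  have hB' (n : ℕ) : ‖(qFact q n)⁻¹‖ ≤ B := hB ⟨n, rfl⟩
  have hA0 := (norm_nonneg _).trans (hA' 0)
  have hB0 := (norm_nonneg _).trans (hB' 0)
  refine ⟨A * (B * B), fun N k => ?_⟩
  unfold gaussBinom
  split_ifs
  · rw [div_eq_mul_inv, mul_inv, norm_mul, norm_mul]
    have := hA' N
    have := hB' k
    have := hB' (N - k)
    gcongr
  · rw [norm_zero]; positivity

/-- Dominated convergence for series: the central Gaussian binomials tend to 1/(q;q)_∞ and are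
uniformly bounded. It serves for both the triple product and the cube identity. -/
theorem tendsto_sum_gaussBinom_mul {q : ℂ} (hq : ‖q‖ < 1) {w : ℤ → ℂ}
    (hw : Summable fun k => ‖w k‖) :
    Tendsto (fun n : ℕ => ∑ k ∈ range (2 * n + 1), gaussBinom q (2 * n) k * w ((k : ℤ) - n))
      atTop (𝓝 ((qPoch q q)⁻¹ * ∑' k, w k)) := by
  have hE := qPoch_ne_zero_of_norm_lt hq hq
  obtain ⟨C, hC⟩ := exists_norm_gaussBinom_le hq
  let c (n : ℕ) (j : ℤ) : ℂ := if 0 ≤ j + n then gaussBinom q (2 * n) (j + n).toNat else 0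
  have hsum (n : ℕ) : ∑ k ∈ range (2 * n + 1), gaussBinom q (2 * n) k * w ((k : ℤ) - n) =
      ∑' j, c n j * w j := by
    have hinj : Function.Injective fun k : ℕ => (k : ℤ) - n := fun a b h => by
      simpa using h
    rw [← hinj.tsum_eq (f := fun j => c n j * w j) ?_]
    · symm
      refine (tsum_eq_sum (s := range (2 * n + 1)) fun k hk => ?_).trans
        (sum_congr rfl fun k _ => by simp [c])
      have : ¬ k ≤ 2 * n := fun h => hk (mem_range.mpr (by omega))
      simp only [c, gaussBinom, sub_add_cancel, Int.toNat_natCast, if_neg this, ite_self, zero_mul]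
    · intro j hj
      have h0 : 0 ≤ j + n := by
        by_contra h
        simp [c, h] at hj
      exact ⟨(j + n).toNat, by simp [Int.toNat_of_nonneg h0]⟩
  simp_rw [hsum, ← tsum_mul_left]
  refine tendsto_tsum_of_dominated_convergence (hw.mul_left C) (fun j => ?_)
    (Eventually.of_forall fun n j => ?_)
  · refine Tendsto.mul_const _ ?_
    have h1 : Tendsto (fun n : ℕ => qFact q (2 * n) / (qFact q (j + n).toNat *
        qFact q (2 * n - (j + n).toNat))) atTop (𝓝 (qPoch q q / (qPoch q q * qPoch q q))) := by
      refine Tendsto.div ?_ (Tendsto.mul ?_ ?_) (mul_ne_zero hE hE)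
      · exact (tendsto_qFact hq).comp (tendsto_id.nsmul_atTop two_pos)
      · refine (tendsto_qFact hq).comp (tendsto_atTop.mpr fun b => ?_)
        filter_upwards [eventually_ge_atTop (b + j.natAbs)] with n hn
        omega
      · refine (tendsto_qFact hq).comp (tendsto_atTop.mpr fun b => ?_)
        filter_upwards [eventually_ge_atTop (b + j.natAbs)] with n hn
        omega
    rw [show qPoch q q / (qPoch q q * qPoch q q) = (qPoch q q)⁻¹ by field_simp] at h1
    refine h1.congr' ?_
    filter_upwards [eventually_ge_atTop j.natAbs] with n hn
    simp only [c, gaussBinom]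
    rw [if_pos (by omega), if_pos (by omega)]
  · rw [norm_mul]
    gcongr
    simp only [c]
    split_ifs
    · exact hC _ _
    · simpa using (norm_nonneg _).trans (hC 0 0)

/-- The Jacobi triple product identity. -/
theorem jacobi_triple_product {q : ℂ} (hq0 : q ≠ 0) (hq : ‖q‖ < 1) {z : ℂ} (hz : z ≠ 0) :
    ∑' k : ℤ, thetaCoeff q k * z ^ k = qPoch q q * qPoch z q * qPoch (q / z) q := by
  have hE := qPoch_ne_zero_of_norm_lt hq hq
  have h1 := tendsto_sum_gaussBinom_mul hq (summable_norm_thetaCoeff hq0 hq hz)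
  have h2 := (tendsto_qPoch z hq).mul (tendsto_qPoch (q / z) hq)
  have h3 := tendsto_nhds_unique (h2.congr fun n => finite_jacobi_triple_product hq0 hq hz n) h1
  rw [mul_assoc, h3, mul_inv_cancel_left₀ hE]

/-- The derivative at z = 1 of the finite triple product of length n + 1. The factor 1 - z vanishes
there, so the left side contributes only minus the remaining product. -/
theorem finite_jacobi_cube {q : ℂ} (hq0 : q ≠ 0) (hq : ‖q‖ < 1) (n : ℕ) :
    -(qFact q n * qFact q (n + 1)) = ∑ k ∈ range (2 * (n + 1) + 1), gaussBinom q (2 * (n + 1)) k *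
        (thetaCoeff q ((k : ℤ) - (n + 1 : ℕ)) * (((k : ℤ) - (n + 1 : ℕ) : ℤ) : ℂ)) := by
  let h (z : ℂ) : ℂ := (∏ i ∈ range n, (1 - z * q ^ (i + 1))) *
    ∏ i ∈ range (n + 1), (1 - q / z * q ^ i)
  have hd : DifferentiableAt ℂ h 1 := by
    refine DifferentiableAt.mul ?_ ?_
    · exact DifferentiableAt.fun_finsetProd fun i _ => by fun_prop
    · exact DifferentiableAt.fun_finsetProd fun i _ => by
        fun_prop (disch := exact one_ne_zero)
  have h1 : HasDerivAt (fun z => (1 - z) * h z) (-1 * h 1 + (1 - 1) * deriv h 1) 1 :=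
    ((hasDerivAt_id (1 : ℂ)).const_sub 1).mul hd.hasDerivAt
  have h2 : HasDerivAt (fun z : ℂ => ∑ k ∈ range (2 * (n + 1) + 1), gaussBinom q (2 * (n + 1)) k *
        (thetaCoeff q ((k : ℤ) - (n + 1 : ℕ)) * z ^ ((k : ℤ) - (n + 1 : ℕ))))
      (∑ k ∈ range (2 * (n + 1) + 1), gaussBinom q (2 * (n + 1)) k *
        (thetaCoeff q ((k : ℤ) - (n + 1 : ℕ)) * ((((k : ℤ) - (n + 1 : ℕ) : ℤ) : ℂ) *
          1 ^ ((k : ℤ) - (n + 1 : ℕ) - 1)))) 1 :=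
    HasDerivAt.fun_sum fun k _ =>
      ((hasDerivAt_zpow _ _ (Or.inl one_ne_zero)).const_mul _).const_mul _
  have h3 : (fun z : ℂ => (1 - z) * h z) =ᶠ[𝓝 1] fun z : ℂ => ∑ k ∈ range (2 * (n + 1) + 1),
      gaussBinom q (2 * (n + 1)) k *
        (thetaCoeff q ((k : ℤ) - (n + 1 : ℕ)) * z ^ ((k : ℤ) - (n + 1 : ℕ))) := by
    filter_upwards [eventually_ne_nhds (one_ne_zero (α := ℂ))] with z hz
    rw [← finite_jacobi_triple_product hq0 hq hz (n + 1), prod_range_succ' (fun i => 1 - z * q ^ i)]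
    simp only [h]
    ring
  have h4 := h1.unique (h2.congr_of_eventuallyEq h3)
  simp only [one_zpow, mul_one, sub_self, zero_mul, add_zero] at h4
  rw [← h4]
  simp [h, qFact, pow_succ']

/-- Jacobi's series for the cube of `(q; q)_∞`. -/
theorem jacobi_cube {q : ℂ} (hq0 : q ≠ 0) (hq : ‖q‖ < 1) :
    ∑' k : ℤ, thetaCoeff q k * k = -qPoch q q ^ 3 := by
  have hE := qPoch_ne_zero_of_norm_lt hq hq
  have hs : Summable fun k : ℤ => ‖thetaCoeff q k * k‖ := by
    have := summable_abs_mul_pow_tri (norm_pos_iff.mpr hq0) hq one_pos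
    simpa [norm_thetaCoeff, mul_comm] using this
  have h1 := (tendsto_sum_gaussBinom_mul hq hs).comp (tendsto_add_atTop_nat 1)
  have h2 := ((tendsto_qFact hq).mul ((tendsto_qFact hq).comp (tendsto_add_atTop_nat 1))).neg
  have h3 := tendsto_nhds_unique (h2.congr fun n => finite_jacobi_cube hq0 hq n) h1
  rw [eq_comm, inv_mul_eq_iff_eq_mul₀ hE] at h3
  rw [h3]
  ring

/-! ### Indefinite double sums over integers -/

/-- The sum over `m, n ≥ 0` minus the sum over `m, n < 0`, for integers `m` and `n`. -/
noncomputable def intIndefSum (F : ℤ → ℤ → ℂ) : ℂ :=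
  ∑' x : ℕ × ℕ, F x.1 x.2 - ∑' x : ℕ × ℕ, F (-(x.1 + 1)) (-(x.2 + 1))

/-- Absolute convergence of the two series in `intIndefSum`. -/
def IntIndefSummable (F : ℤ → ℤ → ℂ) : Prop :=
  (Summable fun x : ℕ × ℕ => F x.1 x.2) ∧ Summable fun x : ℕ × ℕ => F (-(x.1 + 1)) (-(x.2 + 1))

theorem injective_neg_natCast_add_one : Function.Injective fun i : ℕ => -((i : ℤ) + 1) :=
  fun a b h => by simpa using h

theorem neg_natCast_add_one_mul_nonneg (i j : ℕ) : 0 ≤ -((i : ℤ) + 1) * -((j : ℤ) + 1) := by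
  rw [neg_mul_neg]
  positivity

theorem IntIndefSummable.of_norm_le {F : ℤ → ℤ → ℂ} {a b : ℤ → ℂ} (ha : Summable fun k => ‖a k‖)
    (hb : Summable fun k => ‖b k‖) (h : ∀ m n, 0 ≤ m * n → ‖F m n‖ ≤ ‖a m‖ * ‖b n‖) :
    IntIndefSummable F := by
  have hab : Summable fun x : ℤ × ℤ => ‖a x.1‖ * ‖b x.2‖ :=
    ha.mul_of_nonneg hb (fun _ => norm_nonneg _) (fun _ => norm_nonneg _)
  have aux (e : ℕ → ℤ) (he : Function.Injective e) (h0 : ∀ i j, 0 ≤ e i * e j) :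
      Summable fun x : ℕ × ℕ => F (e x.1) (e x.2) :=
    Summable.of_norm_bounded (hab.comp_injective (he.prodMap he)) fun x => h _ _ (h0 _ _)
  exact ⟨aux (fun i => i) Nat.cast_injective fun i j => by positivity,
    aux _ injective_neg_natCast_add_one neg_natCast_add_one_mul_nonneg⟩

theorem intIndefSum_tsum {G : ℤ → ℤ → ℤ → ℂ} {a b c : ℤ → ℂ} (ha : Summable fun k => ‖a k‖)
    (hb : Summable fun k => ‖b k‖) (hc : Summable fun k => ‖c k‖)
    (h : ∀ m n N, 0 ≤ m * n → ‖G m n N‖ ≤ ‖b n‖ * (‖a (m - N)‖ * ‖c N‖)) :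
    intIndefSum (fun m n => ∑' N, G m n N) = ∑' N, intIndefSum fun m n => G m n N := by
  have hac : Summable fun x : ℤ × ℤ => ‖a x.1‖ * ‖c x.2‖ :=
    ha.mul_of_nonneg hc (fun _ => norm_nonneg _) (fun _ => norm_nonneg _)
  have habc : Summable fun x : ℤ × ℤ × ℤ => ‖b x.1‖ * (‖a x.2.1‖ * ‖c x.2.2‖) :=
    hb.mul_of_nonneg hac (fun _ => norm_nonneg _) (fun _ => by positivity)
  have aux (e : ℕ → ℤ) (he : Function.Injective e) (h0 : ∀ i j, 0 ≤ e i * e j) :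
      Summable fun x : (ℕ × ℕ) × ℤ => G (e x.1.1) (e x.1.2) x.2 := by
    -- The bound is a product of functions of n, m - N and N; these determine m, n and N, so the
    -- product series dominates.
    have hinj : Function.Injective fun x : (ℕ × ℕ) × ℤ => (e x.1.2, e x.1.1 - x.2, x.2) := by
      rintro ⟨⟨i, j⟩, k⟩ ⟨⟨i', j'⟩, k'⟩ hx
      simp only [Prod.mk.injEq] at hx
      obtain ⟨h1, h2, rfl⟩ := hx
      rw [he h1, he (sub_left_injective h2)]
    exact Summable.of_norm_bounded (habc.comp_injective hinj) fun x => h _ _ _ (h0 _ _)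
  have hp := aux (fun i => i) Nat.cast_injective fun i j => by positivity
  have hn := aux _ injective_neg_natCast_add_one neg_natCast_add_one_mul_nonneg
  have sp : Summable fun N => ∑' x : ℕ × ℕ, G x.1 x.2 N := hp.prod_symm.prod
  have sn : Summable fun N => ∑' x : ℕ × ℕ, G (-(x.1 + 1)) (-(x.2 + 1)) N := hn.prod_symm.prod
  refine Eq.trans ?_ (sp.tsum_sub sn).symm
  unfold intIndefSum
  congr 1
  · exact (Summable.tsum_comm (f := fun (x : ℕ × ℕ) N => G x.1 x.2 N) hp).symm
  · exact (Summable.tsum_comm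
      (f := fun (x : ℕ × ℕ) N => G (-(x.1 + 1)) (-(x.2 + 1)) N) hn).symm

theorem hasSum_sum_antidiagonal {f : ℕ × ℕ → ℂ} (hf : Summable f) :
    HasSum (fun n => ∑ p ∈ antidiagonal n, f p) (∑' p, f p) := by
  have h := (HasAntidiagonal.sigmaAntidiagonalEquivProd (A := ℕ)).hasSum_iff.mpr hf.hasSum
  refine h.sigma fun n => ?_
  have := hasSum_fintype fun p : antidiagonal n => f p
  rw [← Finset.sum_coe_sort]
  exact this

/-! ### Diagonal summation and the zeros of theta -/

/-- The coefficients of the theta function with zeros at the powers of `Q`. -/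
noncomputable def shiftedThetaCoeff (Q : ℂ) (k : ℤ) : ℂ := (-1) ^ k * Q ^ tri (k + 1)

theorem thetaCoeff_add_one (Q : ℂ) (k : ℤ) : thetaCoeff Q (k + 1) = -shiftedThetaCoeff Q k := by
  rw [thetaCoeff, shiftedThetaCoeff, zpow_add_one₀ (by norm_num)]
  ring

theorem norm_shiftedThetaCoeff (Q : ℂ) (k : ℤ) : ‖shiftedThetaCoeff Q k‖ = ‖Q‖ ^ tri (k + 1) := by
  simp [shiftedThetaCoeff, norm_zpow]

theorem summable_norm_shiftedThetaCoeff {Q : ℂ} (hQ0 : Q ≠ 0) (hQ : ‖Q‖ < 1) {z : ℂ}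
    (hz : z ≠ 0) : Summable fun k => ‖shiftedThetaCoeff Q k * z ^ k‖ := by
  refine (((Equiv.addRight (1 : ℤ)).summable_iff.mpr
    (summable_norm_thetaCoeff hQ0 hQ hz)).mul_right ‖z‖⁻¹).congr fun k => ?_
  simp only [Function.comp, Equiv.coe_addRight]
  rw [thetaCoeff_add_one, zpow_add_one₀ hz, ← mul_assoc, norm_mul _ z,
    mul_inv_cancel_right₀ (norm_ne_zero_iff.mpr hz), neg_mul, norm_neg]

theorem tsum_shiftedThetaCoeff {Q : ℂ} (hQ0 : Q ≠ 0) (hQ : ‖Q‖ < 1) {z : ℂ} (hz : z ≠ 0) :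
    ∑' k, shiftedThetaCoeff Q k * z ^ k = qPoch Q Q * qPoch (z * Q) Q * qPoch z⁻¹ Q := by
  have h := jacobi_triple_product hQ0 hQ (mul_ne_zero hz hQ0)
  rw [div_mul_cancel_right₀ hQ0] at h
  rw [← h]
  refine tsum_congr fun k => ?_
  rw [shiftedThetaCoeff, thetaCoeff, tri_add_one, zpow_add₀ hQ0, mul_zpow]
  ring

theorem norm_zpow_le_one {Q : ℂ} (hQ : ‖Q‖ < 1) {k : ℤ} (hk : 0 ≤ k) : ‖Q ^ k‖ ≤ 1 := by
  lift k to ℕ using hk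
  rw [zpow_natCast, norm_pow]
  exact pow_le_one₀ (norm_nonneg _) hQ.le

/-- The exponent of the sum exceeds the sum of the exponents by mn, which is nonnegative on both
quadrants of an indefinite sum. -/
theorem norm_shiftedThetaCoeff_add_le {Q : ℂ} (hQ0 : Q ≠ 0) (hQ : ‖Q‖ < 1) {m n : ℤ}
    (h : 0 ≤ m * n) :
    ‖shiftedThetaCoeff Q (m + n)‖ ≤ ‖shiftedThetaCoeff Q m‖ * ‖shiftedThetaCoeff Q n‖ := by
  have e : tri (m + n + 1) = tri (m + 1) + tri (n + 1) + m * n := by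
    have h1 := two_mul_tri (m + n + 1)
    have h2 := two_mul_tri (m + 1)
    have h3 := two_mul_tri (n + 1)
    linarith
  have hQ0' := norm_ne_zero_iff.mpr hQ0
  rw [norm_shiftedThetaCoeff, norm_shiftedThetaCoeff, norm_shiftedThetaCoeff, e,
    zpow_add₀ hQ0', zpow_add₀ hQ0']
  have := norm_zpow_le_one hQ h
  rw [norm_zpow] at this
  exact mul_le_of_le_one_right (by positivity) this

/-- Grouping by k = m + n. The recursion makes g(k) the sum of x^m over 0 ≤ m ≤ k when k ≥ 0, and
minus the sum over k < m < 0 when k < 0, so the sign of the negative quadrant is built in. Stating g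
by its recursion covers x = 1 and x ≠ 1 together. -/
theorem hasSum_intIndefSum_add {Q : ℂ} (hQ0 : Q ≠ 0) (hQ : ‖Q‖ < 1) {x : ℂ} (hx : x ≠ 0)
    {g : ℤ → ℂ} (hg0 : g (-1) = 0) (hg : ∀ k, g k = g (k - 1) + x ^ k) :
    HasSum (fun k => shiftedThetaCoeff Q k * g k)
      (intIndefSum fun m n => shiftedThetaCoeff Q (m + n) * x ^ m) := by
  have hT := summable_norm_shiftedThetaCoeff hQ0 hQ one_ne_zero
  simp only [one_zpow, mul_one] at hT
  have hs : IntIndefSummable fun m n => shiftedThetaCoeff Q (m + n) * x ^ m := by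
    refine .of_norm_le (summable_norm_shiftedThetaCoeff hQ0 hQ hx) hT fun m n hmn => ?_
    rw [norm_mul, norm_mul, mul_right_comm]
    gcongr
    exact norm_shiftedThetaCoeff_add_le hQ0 hQ hmn
  have hpos (k : ℕ) : g k = ∑ i ∈ range (k + 1), x ^ i := by
    induction k with
    | zero => rw [hg]; simp [hg0]
    | succ k ih =>
      rw [hg, sum_range_succ, ← ih]
      push_cast
      rw [add_sub_cancel_right, ← zpow_natCast x (k + 1)]
      push_cast
      rfl
  have hneg (k : ℕ) : g (-((k + 1 : ℕ) + 1)) = -∑ i ∈ range (k + 1), x ^ (-((i : ℤ) + 1)) := by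
    induction k with
    | zero =>
      have := hg (-1)
      rw [hg0] at this
      norm_num at this ⊢
      linear_combination -this
    | succ k ih =>
      rw [sum_range_succ, neg_add (∑ i ∈ range (k + 1), _), ← ih]
      have := hg (-((k + 1 : ℕ) + 1))
      rw [show -(((k + 1 : ℕ) : ℤ) + 1) - 1 = -((k + 1 + 1 : ℕ) + 1) by push_cast; ring] at this
      rw [this]
      push_cast
      ring
  rw [intIndefSum, sub_eq_add_neg]
  refine HasSum.of_nat_of_neg_add_one ?_ ?_
  · convert! hasSum_sum_antidiagonal hs.1 using 2 with k
    rw [hpos, Nat.sum_antidiagonal_eq_sum_range_succ_mk, mul_sum]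
    refine sum_congr rfl fun i hi => ?_
    have := mem_range.mp hi
    simp only
    rw [zpow_natCast, ← Nat.cast_add, Nat.add_sub_cancel' (by omega)]
  · have h := (hasSum_sum_antidiagonal hs.2).neg
    have h2 : HasSum (fun k : ℕ => shiftedThetaCoeff Q (-((k + 1 : ℕ) + 1)) *
        g (-((k + 1 : ℕ) + 1)))
        (-∑' y : ℕ × ℕ, shiftedThetaCoeff Q (-(y.1 + 1) + -(y.2 + 1)) * x ^ (-((y.1 : ℤ) + 1))) := by
      convert! h using 2 with k
      rw [hneg, Nat.sum_antidiagonal_eq_sum_range_succ_mk, mul_neg, mul_sum]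
      congr 1
      refine sum_congr rfl fun i hi => ?_
      have := mem_range.mp hi
      congr 2
      omega
    -- The negative quadrant starts at k = -2; the missing term k = -1 is zero because g(-1) = 0.
    have h3 := (hasSum_nat_add_iff (f := fun k : ℕ => shiftedThetaCoeff Q (-(k + 1)) *
      g (-((k : ℤ) + 1))) 1).mp h2
    simpa [hg0] using h3

theorem qPoch_eq_zero {x q : ℂ} (n : ℕ) (h : x * q ^ n = 1) : qPoch x q = 0 :=
  tprod_of_exists_eq_zero ⟨n, by rw [h, sub_self]⟩

/-- At a power of Q one factor of the triple product vanishes: in (z;Q)_∞ if N ≤ 0, in (Q/z;Q)_∞ if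
N > 0. -/
theorem tsum_thetaCoeff_mul_zpow_eq_zero {Q : ℂ} (hQ0 : Q ≠ 0) (hQ : ‖Q‖ < 1) (N : ℤ) :
    ∑' k, thetaCoeff Q k * (Q ^ N) ^ k = 0 := by
  rw [jacobi_triple_product hQ0 hQ (zpow_ne_zero N hQ0)]
  rcases le_or_gt N 0 with h | h
  · obtain ⟨n, rfl⟩ : ∃ n : ℕ, N = -n := ⟨N.natAbs, by omega⟩
    rw [qPoch_eq_zero (x := Q ^ (-(n : ℤ))) n
      (by rw [zpow_neg, zpow_natCast]; exact inv_mul_cancel₀ (pow_ne_zero _ hQ0))]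
    ring
  · obtain ⟨n, rfl⟩ : ∃ n : ℕ, N = n + 1 := ⟨(N - 1).natAbs, by omega⟩
    rw [qPoch_eq_zero (x := Q / Q ^ ((n : ℤ) + 1)) n
      (by rw [zpow_add_one₀ hQ0, zpow_natCast]; have := pow_ne_zero n hQ0; field_simp)]
    ring

theorem zpow_ne_one_of_norm_lt {Q : ℂ} (hQ : ‖Q‖ < 1) {N : ℤ} (hN : N ≠ 0) :
    Q ^ N ≠ 1 := by
  intro h
  have h1 := congrArg norm h
  rw [norm_zpow, norm_one, zpow_eq_one_iff_right₀ (norm_nonneg _) hQ.ne] at h1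
  exact hN h1

/-- The diagonal m + n = k carries weight k + 1, and shifting k by one gives the series of Jacobi's
cube identity. -/
theorem intIndefSum_shiftedThetaCoeff_one {Q : ℂ} (hQ0 : Q ≠ 0) (hQ : ‖Q‖ < 1) :
    intIndefSum (fun m n => shiftedThetaCoeff Q (m + n) * 1 ^ m) = qPoch Q Q ^ 3 := by
  have h := hasSum_intIndefSum_add hQ0 hQ one_ne_zero (g := fun k => (k + 1 : ℤ)) (by simp)
    (fun k => by simp)
  rw [← h.tsum_eq, ← neg_neg (qPoch Q Q ^ 3), ← jacobi_cube hQ0 hQ,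
    ← (Equiv.addRight (1 : ℤ)).tsum_eq (fun k : ℤ => thetaCoeff Q k * k), ← tsum_neg]
  exact tsum_congr fun k => by simp [thetaCoeff_add_one]

/-- The diagonal weights form a geometric sum, so the total is a multiple of the difference of two
theta values at integer powers of Q, both zero. -/
theorem intIndefSum_shiftedThetaCoeff_zpow {Q : ℂ} (hQ0 : Q ≠ 0) (hQ : ‖Q‖ < 1) {N : ℤ}
    (hN : N ≠ 0) : intIndefSum (fun m n => shiftedThetaCoeff Q (m + n) * (Q ^ N) ^ m) = 0 := by
  have hx := zpow_ne_zero N hQ0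
  have hx1 := sub_ne_zero.mpr (zpow_ne_one_of_norm_lt hQ hN).symm
  have h := hasSum_intIndefSum_add hQ0 hQ hx
    (g := fun k => (1 - (Q ^ N) ^ (k + 1)) / (1 - Q ^ N)) (by simp) (fun k => by
      rw [sub_add_cancel, zpow_add_one₀ hx]
      field_simp
      ring)
  have s1 := (summable_norm_thetaCoeff hQ0 hQ one_ne_zero).of_norm
  have s2 := (summable_norm_thetaCoeff hQ0 hQ hx).of_norm
  have h0 := tsum_thetaCoeff_mul_zpow_eq_zero hQ0 hQ 0
  rw [zpow_zero] at h0
  have e : ∑' k, (thetaCoeff Q k * 1 ^ k - thetaCoeff Q k * (Q ^ N) ^ k) = 0 := by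
    rw [s1.tsum_sub s2, h0, tsum_thetaCoeff_mul_zpow_eq_zero hQ0 hQ, sub_zero]
  rw [← h.tsum_eq, ← mul_zero (-(1 - Q ^ N)⁻¹), ← e, ← (Equiv.addRight (1 : ℤ)).tsum_eq
    (fun k => thetaCoeff Q k * 1 ^ k - thetaCoeff Q k * (Q ^ N) ^ k), ← tsum_mul_left]
  refine tsum_congr fun k => ?_
  simp only [Equiv.coe_addRight, thetaCoeff_add_one, one_zpow]
  field_simp
  ring

/-- An indefinite sum whose coefficients in one variable form the convolution of a theta series
with `r` is the central coefficient `r 0` times `(Q; Q)_∞ ^ 3`. -/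
theorem intIndefSum_convolution {Q : ℂ} (hQ0 : Q ≠ 0) (hQ : ‖Q‖ < 1) {r v : ℤ → ℂ}
    (hr : Summable fun k => ‖r k‖) (hv : ∀ m, v m = ∑' N, shiftedThetaCoeff Q (m - N) * r N) :
    intIndefSum (fun m n => shiftedThetaCoeff Q n * Q ^ (n * m) * v m) =
      r 0 * qPoch Q Q ^ 3 := by
  have hT := summable_norm_shiftedThetaCoeff hQ0 hQ one_ne_zero
  simp only [one_zpow, mul_one] at hT
  have h1 : (intIndefSum fun m n => shiftedThetaCoeff Q n * Q ^ (n * m) * v m) =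
      ∑' N, intIndefSum fun m n =>
        shiftedThetaCoeff Q n * Q ^ (n * m) * (shiftedThetaCoeff Q (m - N) * r N) := by
    rw [← intIndefSum_tsum hT hT hr]
    · simp_rw [hv, tsum_mul_left]
    · intro m n N hmn
      rw [norm_mul, norm_mul, norm_mul (shiftedThetaCoeff Q (m - N))]
      gcongr
      exact mul_le_of_le_one_right (norm_nonneg _)
        (norm_zpow_le_one hQ (by rwa [mul_comm]))
  -- Completing the square: the dependence on m and n becomes T(m+n) x^m with x = Q^(-N).
  have h2 (N m n : ℤ) :
      shiftedThetaCoeff Q n * Q ^ (n * m) * (shiftedThetaCoeff Q (m - N) * r N) =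
        ((-1) ^ N * Q ^ tri N * r N) * (shiftedThetaCoeff Q (m + n) * (Q ^ (-N)) ^ m) := by
    have e1 : Q ^ tri (n + 1) * Q ^ (n * m) * Q ^ tri (m - N + 1) =
        Q ^ tri N * (Q ^ tri (m + n + 1) * (Q ^ (-N)) ^ m) := by
      rw [← zpow_mul, ← zpow_add₀ hQ0, ← zpow_add₀ hQ0, ← zpow_add₀ hQ0, ← zpow_add₀ hQ0]
      congr 1
      have a1 := two_mul_tri (n + 1)
      have a2 := two_mul_tri (m - N + 1)
      have a3 := two_mul_tri N
      have a4 := two_mul_tri (m + n + 1)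
      linarith
    have e2 : (-1 : ℂ) ^ n * (-1) ^ (m - N) = (-1) ^ N * (-1) ^ (m + n) := by
      rw [zpow_sub₀ (by norm_num), zpow_add₀ (by norm_num)]
      have : (-1 : ℂ) ^ N * (-1) ^ N = 1 := by rw [← mul_zpow]; simp
      have h0 : (-1 : ℂ) ^ N ≠ 0 := zpow_ne_zero _ (by norm_num)
      field_simp
      linear_combination -1 * this
    rw [shiftedThetaCoeff, shiftedThetaCoeff, shiftedThetaCoeff]
    linear_combination (r N * ((-1 : ℂ) ^ n * (-1) ^ (m - N))) * e1 +
      (r N * (Q ^ tri N * (Q ^ tri (m + n + 1) * (Q ^ (-N)) ^ m))) * e2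
  have h3 (N : ℤ) : (intIndefSum fun m n => shiftedThetaCoeff Q n * Q ^ (n * m) *
      (shiftedThetaCoeff Q (m - N) * r N)) = (-1) ^ N * Q ^ tri N * r N *
        intIndefSum fun m n => shiftedThetaCoeff Q (m + n) * (Q ^ (-N)) ^ m := by
    simp_rw [h2]
    rw [intIndefSum, intIndefSum, tsum_mul_left, tsum_mul_left, mul_sub]
  simp_rw [h1, h3]
  -- Every N ≠ 0 drops out, since x = Q^(-N) is then a nontrivial power of Q.
  rw [tsum_eq_single 0]
  · rw [neg_zero, zpow_zero, zpow_zero, intIndefSum_shiftedThetaCoeff_one hQ0 hQ]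
    simp [tri]
  · intro N hN
    rw [intIndefSum_shiftedThetaCoeff_zpow hQ0 hQ (neg_ne_zero.mpr hN), mul_zero]

theorem intIndefSummable_mul_coeff {Q : ℂ} (hQ0 : Q ≠ 0) (hQ : ‖Q‖ < 1) {v : ℤ → ℂ}
    (hv : Summable fun k => ‖v k‖) :
    IntIndefSummable fun m n => shiftedThetaCoeff Q n * Q ^ (n * m) * v m := by
  have hT := summable_norm_shiftedThetaCoeff hQ0 hQ one_ne_zero
  simp only [one_zpow, mul_one] at hT
  refine .of_norm_le hv hT fun m n hmn => ?_
  rw [norm_mul, norm_mul, mul_comm ‖v m‖]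
  gcongr
  exact mul_le_of_le_one_right (norm_nonneg _) (norm_zpow_le_one hQ (by rwa [mul_comm]))

/-! ### Laurent coefficients: uniqueness and convolution -/

/-- A Laurent coefficient is a Fourier coefficient of the restriction to the unit circle. -/
theorem coeff_eq_integral {a : ℤ → ℂ} (ha : Summable fun k => ‖a k‖) (n : ℤ) :
    a n = ∫ t : AddCircle (1 : ℝ), ∑' k : ℤ, fourier (-n) t • (a k * (AddCircle.toCircle t : ℂ) ^ k)
      ∂AddCircle.haarAddCircle := by
  have hpow (t : AddCircle (1 : ℝ)) (k : ℤ) : (AddCircle.toCircle t : ℂ) ^ k = fourier k t := by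
    rw [fourier_apply, AddCircle.toCircle_zsmul, Circle.coe_zpow]
  simp_rw [hpow]
  have hcoeff (k : ℤ) : ∫ t : AddCircle (1 : ℝ), fourier (-n) t • (a k * fourier k t)
      ∂AddCircle.haarAddCircle = if k = n then a k else 0 := by
    have h := fourierCoeff.const_mul (T := (1 : ℝ)) (fun t => fourier k t) (a k) n
    have h2 := congrFun (fourierCoeff_fourier (T := (1 : ℝ)) k) n
    rw [h2] at h
    rw [fourierCoeff] at h
    rw [h, Pi.single_apply]
    simp [eq_comm]
  have hs := MeasureTheory.hasSum_integral_of_summable_integral_norm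
    (μ := (AddCircle.haarAddCircle : MeasureTheory.Measure (AddCircle (1 : ℝ))))
    (F := fun (k : ℤ) t => fourier (-n) t • (a k * fourier k t)) (fun k => ?_) ?_
  · rw [← hs.tsum_eq]
    simp_rw [hcoeff]
    rw [tsum_ite_eq]
  · exact (Continuous.integrable_of_hasCompactSupport (by fun_prop)
      (HasCompactSupport.of_compactSpace _))
  · refine ha.congr fun k => ?_
    have (t : AddCircle (1 : ℝ)) : ‖fourier (-n) t • (a k * fourier k t)‖ = ‖a k‖ := by
      have h1 (m : ℤ) : ‖fourier m t‖ = 1 := by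
        rw [fourier_apply]
        exact Circle.norm_coe _
      rw [norm_smul, norm_mul, h1, h1, one_mul, mul_one]
    simp_rw [this]
    simp

theorem laurent_coeff_unique {a b : ℤ → ℂ} (ha : Summable fun k => ‖a k‖)
    (hb : Summable fun k => ‖b k‖)
    (h : ∀ z : ℂ, ‖z‖ = 1 → ∑' k, a k * z ^ k = ∑' k, b k * z ^ k) : a = b := by
  funext n
  rw [coeff_eq_integral ha, coeff_eq_integral hb]
  refine MeasureTheory.integral_congr_ae (Eventually.of_forall fun t => ?_)
  simp only [smul_eq_mul, tsum_mul_left]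
  rw [h _ (Circle.norm_coe _)]

/-- The convolution of two sequences of Laurent coefficients. -/
noncomputable def laurentConv (a b : ℤ → ℂ) (m : ℤ) : ℂ := ∑' N, a (m - N) * b N

/-- The shear `(m, N) ↦ (m - N, N)`. -/
def intShear : ℤ × ℤ ≃ ℤ × ℤ where
  toFun x := (x.1 - x.2, x.2)
  invFun x := (x.1 + x.2, x.2)
  left_inv x := by simp
  right_inv x := by simp

theorem summable_norm_laurentConv_aux {a b : ℤ → ℂ} (ha : Summable fun k => ‖a k‖)
    (hb : Summable fun k => ‖b k‖) : Summable fun x : ℤ × ℤ => ‖a (x.1 - x.2) * b x.2‖ := by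
  have h := ha.mul_of_nonneg hb (fun _ => norm_nonneg _) (fun _ => norm_nonneg _)
  refine (intShear.summable_iff.mpr h).congr fun x => ?_
  simp [intShear]

theorem summable_norm_laurentConv {a b : ℤ → ℂ} (ha : Summable fun k => ‖a k‖)
    (hb : Summable fun k => ‖b k‖) : Summable fun k => ‖laurentConv a b k‖ := by
  have h := summable_norm_laurentConv_aux ha hb
  exact Summable.of_nonneg_of_le (fun _ => norm_nonneg _)
    (fun m => norm_tsum_le_tsum_norm (h.prod_factor m)) h.prod

theorem tsum_laurentConv {a b : ℤ → ℂ} (ha : Summable fun k => ‖a k‖)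
    (hb : Summable fun k => ‖b k‖) {z : ℂ} (hz : ‖z‖ = 1) :
    ∑' k, laurentConv a b k * z ^ k = (∑' k, a k * z ^ k) * ∑' k, b k * z ^ k := by
  have hz0 : z ≠ 0 := by
    rintro rfl
    simp at hz
  have ha' : Summable fun k => ‖a k * z ^ k‖ := by simpa [norm_zpow, hz] using ha
  have hb' : Summable fun k => ‖b k * z ^ k‖ := by simpa [norm_zpow, hz] using hb
  rw [tsum_mul_tsum_of_summable_norm ha' hb', ← intShear.tsum_eq]
  refine Eq.trans (tsum_congr fun m => ?_)
    (Summable.tsum_prod (summable_norm_laurentConv_aux ha' hb').of_norm).symm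
  rw [laurentConv, ← tsum_mul_right]
  refine tsum_congr fun N => ?_
  rw [show z ^ m = z ^ (m - N) * z ^ N by rw [← zpow_add₀ hz0, sub_add_cancel]]
  ring

theorem ne_zero_of_norm_eq_one {z : ℂ} (hz : ‖z‖ = 1) : z ≠ 0 := by
  rintro rfl
  simp at hz

/-- The form used in applications: a factorization of functions on the unit circle gives the
convolution of coefficients by uniqueness. -/
theorem intIndefSum_of_tsum_eq {Q : ℂ} (hQ0 : Q ≠ 0) (hQ : ‖Q‖ < 1) {r v : ℤ → ℂ}
    (hr : Summable fun k => ‖r k‖) (hv : Summable fun k => ‖v k‖)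
    (h : ∀ z : ℂ, ‖z‖ = 1 → ∑' k, v k * z ^ k =
      qPoch Q Q * qPoch (z * Q) Q * qPoch z⁻¹ Q * ∑' k, r k * z ^ k) :
    intIndefSum (fun m n => shiftedThetaCoeff Q n * Q ^ (n * m) * v m) = r 0 * qPoch Q Q ^ 3 := by
  have hT := summable_norm_shiftedThetaCoeff hQ0 hQ one_ne_zero
  simp only [one_zpow, mul_one] at hT
  refine intIndefSum_convolution hQ0 hQ hr fun m => ?_
  refine congrFun (laurent_coeff_unique hv (summable_norm_laurentConv hT hr) fun z hz => ?_) m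
  rw [h z hz, tsum_laurentConv hT hr hz,
    tsum_shiftedThetaCoeff hQ0 hQ (ne_zero_of_norm_eq_one hz)]

/-! ### The indefinite sums with base q³ -/

theorem tsum_thetaCoeff_mul_pow {Q : ℂ} (hQ0 : Q ≠ 0) (hQ : ‖Q‖ < 1) {x z : ℂ} (hx : x ≠ 0)
    (hz : z ≠ 0) : ∑' k, thetaCoeff Q k * x ^ k * z ^ k =
      qPoch Q Q * qPoch (x * z) Q * qPoch (Q / (x * z)) Q := by
  rw [← jacobi_triple_product hQ0 hQ (mul_ne_zero hx hz)]
  exact tsum_congr fun k => by rw [mul_zpow, mul_assoc]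

theorem tri_neg_add_tri (N : ℤ) : tri (-N) + tri N = N ^ 2 := by
  have h1 := two_mul_tri (-N)
  have h2 := two_mul_tri N
  nlinarith

/-- The constant term pairs index -N with N: the signs cancel and the triangular exponents add up to
N². -/
theorem laurentConv_thetaCoeff_zero {Q : ℂ} (hQ0 : Q ≠ 0) (x y : ℂ) :
    laurentConv (fun k => thetaCoeff Q k * x ^ k) (fun k => thetaCoeff Q k * y ^ k) 0 =
      ∑' N : ℤ, Q ^ (N ^ 2) * (y / x) ^ N := by
  refine tsum_congr fun N => ?_
  simp only [zero_sub, thetaCoeff]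
  rw [← tri_neg_add_tri, zpow_add₀ hQ0, div_zpow, zpow_neg x,
    zpow_neg (-1 : ℂ)]
  have : (-1 : ℂ) ^ N ≠ 0 := zpow_ne_zero _ (by norm_num)
  field_simp

/-- The indefinite sums attached to the form `(m ^ 2 + 6 m n + 3 n ^ 2) / 2`, with the linear term
in `m` given by an integer power `q ^ (s m)`. -/
theorem intIndefSum_three {q : ℂ} (hq0 : q ≠ 0) (hq : ‖q‖ < 1) (s : ℕ) {x y : ℂ} (hx : x ≠ 0)
    (hy : y ≠ 0)
    (h : ∀ z : ℂ, z ≠ 0 → qPoch (q ^ s * z * q) q * qPoch (q ^ s * z)⁻¹ q =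
      qPoch (z * q ^ 3) (q ^ 3) * qPoch z⁻¹ (q ^ 3) *
      (qPoch (x * z) (q ^ 3) * qPoch (q ^ 3 / (x * z)) (q ^ 3)) *
      (qPoch (y * z) (q ^ 3) * qPoch (q ^ 3 / (y * z)) (q ^ 3))) :
    intIndefSum (fun m n => shiftedThetaCoeff (q ^ 3) n * (q ^ 3) ^ (n * m) *
      (shiftedThetaCoeff q m * (q ^ s) ^ m)) =
      qPoch q q * ∑' N : ℤ, (q ^ 3) ^ (N ^ 2) * (y / x) ^ N := by
  have hQ0 : q ^ 3 ≠ 0 := pow_ne_zero 3 hq0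
  have hQ := norm_pow_lt_one hq three_ne_zero
  have hE := qPoch_ne_zero_of_norm_lt hQ hQ
  have hx' : Summable fun k => ‖thetaCoeff (q ^ 3) k * x ^ k‖ := summable_norm_thetaCoeff hQ0 hQ hx
  have hy' : Summable fun k => ‖thetaCoeff (q ^ 3) k * y ^ k‖ := summable_norm_thetaCoeff hQ0 hQ hy
  have key := intIndefSum_of_tsum_eq hQ0 hQ (v := fun m => shiftedThetaCoeff q m * (q ^ s) ^ m)
    (r := fun k => qPoch q q / qPoch (q ^ 3) (q ^ 3) ^ 3 * laurentConv
      (fun k => thetaCoeff (q ^ 3) k * x ^ k) (fun k => thetaCoeff (q ^ 3) k * y ^ k) k)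
    ?_ (summable_norm_shiftedThetaCoeff hq0 hq (pow_ne_zero s hq0)) ?_
  · rw [key, laurentConv_thetaCoeff_zero hQ0]
    field_simp
  · simp_rw [norm_mul (qPoch q q / _)]
    exact (summable_norm_laurentConv hx' hy').mul_left _
  · intro z hz
    have hz0 := ne_zero_of_norm_eq_one hz
    simp_rw [mul_assoc (qPoch q q / _), mul_assoc (shiftedThetaCoeff q _), ← mul_zpow]
    rw [tsum_mul_left, tsum_laurentConv hx' hy' hz, tsum_thetaCoeff_mul_pow hQ0 hQ hx hz0,
      tsum_thetaCoeff_mul_pow hQ0 hQ hy hz0,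
      tsum_shiftedThetaCoeff hq0 hq (mul_ne_zero (pow_ne_zero s hq0) hz0), mul_assoc, h z hz0]
    field_simp

/-- Sorting the factors mod 3, the zeros in the class of 1 belong to Θ_Q(z), and the classes shifted
by q and q² give the other two theta functions. -/
theorem intIndefSum_halfLeft {q : ℂ} (hq0 : q ≠ 0) (hq : ‖q‖ < 1) :
    intIndefSum (fun m n => shiftedThetaCoeff (q ^ 3) n * (q ^ 3) ^ (n * m) *
      (shiftedThetaCoeff q m * (q ^ 0) ^ m)) =
      qPoch q q * ∑' N : ℤ, (q ^ 3) ^ (N ^ 2) * q ^ N := by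
  rw [intIndefSum_three hq0 hq 0 hq0 (pow_ne_zero 2 hq0)]
  · rw [show q ^ 2 / q = q by field_simp]
  · intro z hz
    rw [qPoch_split_three _ hq, qPoch_split_three (q ^ 0 * z)⁻¹ hq,
      show q ^ 0 * z * q = q * z by ring, show q * z * q = q ^ 2 * z by ring,
      show q * z * q ^ 2 = z * q ^ 3 by ring, show (q ^ 0 * z)⁻¹ = z⁻¹ by simp,
      show q ^ 3 / (q * z) = z⁻¹ * q ^ 2 by field_simp,
      show q ^ 3 / (q ^ 2 * z) = z⁻¹ * q by field_simp]
    ring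

/-- Here x = q² and y = q⁴; taking q⁴ rather than q makes the factors of Θ_q(qz) match without a
quasi-period factor. -/
theorem intIndefSum_halfRight {q : ℂ} (hq0 : q ≠ 0) (hq : ‖q‖ < 1) :
    intIndefSum (fun m n => shiftedThetaCoeff (q ^ 3) n * (q ^ 3) ^ (n * m) *
      (shiftedThetaCoeff q m * (q ^ 1) ^ m)) =
      qPoch q q * ∑' N : ℤ, (q ^ 3) ^ (N ^ 2) * (q ^ 2) ^ N := by
  rw [intIndefSum_three hq0 hq 1 (pow_ne_zero 2 hq0) (pow_ne_zero 4 hq0)]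
  · rw [show q ^ 4 / q ^ 2 = q ^ 2 by field_simp]
  · intro z hz
    rw [qPoch_split_three _ hq, qPoch_split_three (q ^ 1 * z)⁻¹ hq,
      show q ^ 1 * z * q = q ^ 2 * z by ring, show q ^ 2 * z * q = z * q ^ 3 by ring,
      show q ^ 2 * z * q ^ 2 = q ^ 4 * z by ring,
      show q ^ 3 / (q ^ 2 * z) = z⁻¹ * q by field_simp,
      show q ^ 3 / (q ^ 4 * z) = (q ^ 1 * z)⁻¹ by field_simp,
      show (q ^ 1 * z)⁻¹ * q = z⁻¹ by field_simp,
      show (q ^ 1 * z)⁻¹ * q ^ 2 = z⁻¹ * q by field_simp]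
    ring

/-! ### The first identity: theta in z² -/

/-- The coefficients of `f (z ^ 2)` when `a` are those of `f z`. -/
noncomputable def evenExtend (a : ℤ → ℂ) (k : ℤ) : ℂ := if Even k then a (k / 2) else 0

theorem evenExtend_two_mul (a : ℤ → ℂ) (k : ℤ) : evenExtend a (2 * k) = a k := by
  simp [evenExtend]

theorem evenExtend_of_notMem {a : ℤ → ℂ} {k : ℤ} (h : k ∉ Set.range fun j : ℤ => 2 * j) :
    evenExtend a k = 0 := by
  rw [evenExtend, if_neg]
  rintro ⟨j, rfl⟩
  exact h ⟨j, by ring⟩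

theorem injective_two_mul : Function.Injective fun j : ℤ => 2 * j := fun a b h => by
  simpa using h

theorem summable_norm_evenExtend {a : ℤ → ℂ} (ha : Summable fun k => ‖a k‖) :
    Summable fun k => ‖evenExtend a k‖ := by
  rw [← injective_two_mul.summable_iff fun k hk => by rw [evenExtend_of_notMem hk, norm_zero]]
  exact ha.congr fun k => by simp [evenExtend_two_mul]

theorem tsum_mul_evenExtend (a b : ℤ → ℂ) :
    ∑' k, b k * evenExtend a k = ∑' k, b (2 * k) * a k := by
  rw [← injective_two_mul.tsum_eq]
  · simp [evenExtend_two_mul]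
  · intro k hk
    by_contra h
    simp [evenExtend_of_notMem h] at hk

theorem tsum_evenExtend (a : ℤ → ℂ) (z : ℂ) :
    ∑' k, evenExtend a k * z ^ k = ∑' k, a k * (z ^ 2) ^ k := by
  refine (tsum_congr fun k => mul_comm _ _).trans
    ((tsum_mul_evenExtend a fun k => z ^ k).trans (tsum_congr fun k => ?_))
  rw [zpow_mul, mul_comm]
  norm_cast

theorem intIndefSum_mul_evenExtend (F : ℤ → ℤ → ℂ) (a : ℤ → ℂ) :
    intIndefSum (fun m n => F m n * evenExtend a m) =
      intIndefSum fun m n => F (2 * m) n * a m := by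
  rw [intIndefSum, intIndefSum]
  congr 1
  · have hinj : Function.Injective fun x : ℕ × ℕ => (2 * x.1, x.2) := by
      rintro ⟨i, j⟩ ⟨i', j'⟩ h
      simpa using h
    rw [← hinj.tsum_eq]
    · simp [evenExtend_two_mul]
    · rintro ⟨i, j⟩ hx
      by_contra h
      refine hx ?_
      simp only
      rw [evenExtend_of_notMem, mul_zero]
      rintro ⟨l, hl⟩
      exact h ⟨(l.toNat, j), by
        simp only at hl
        ext <;> simp only
        omega⟩
  · have hinj : Function.Injective fun x : ℕ × ℕ => (2 * x.1 + 1, x.2) := by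
      rintro ⟨i, j⟩ ⟨i', j'⟩ h
      simpa using h
    rw [← hinj.tsum_eq]
    · refine tsum_congr fun x => ?_
      simp only
      rw [show -(((2 * x.1 + 1 : ℕ) : ℤ) + 1) = 2 * -(x.1 + 1) by push_cast; ring,
        evenExtend_two_mul]
    · rintro ⟨i, j⟩ hx
      by_contra h
      refine hx ?_
      simp only
      rw [evenExtend_of_notMem, mul_zero]
      rintro ⟨l, hl⟩
      exact h ⟨((-l - 1).toNat, j), by
        simp only at hl
        ext <;> simp only
        omega⟩

/-- Euler's pentagonal number theorem in base q²: the triple product in base q⁶ at z = q², its three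
products being the residue classes mod 3 of (q²;q²)_∞. -/
theorem tsum_pentagonal {q : ℂ} (hq0 : q ≠ 0) (hq : ‖q‖ < 1) :
    ∑' k : ℤ, (-1) ^ k * q ^ (3 * k ^ 2 - k) = qPoch (q ^ 2) (q ^ 2) := by
  have h6 := norm_pow_lt_one hq (m := 6) (by norm_num)
  have h2 := norm_pow_lt_one hq two_ne_zero
  have h := jacobi_triple_product (pow_ne_zero 6 hq0) h6 (pow_ne_zero 2 hq0)
  rw [qPoch_split_three _ h2, ← pow_mul, show q ^ 2 * q ^ 2 = q ^ 4 by ring,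
    show q ^ 2 * (q ^ 2) ^ 2 = q ^ 6 by ring]
  rw [show q ^ 6 / q ^ 2 = q ^ 4 by field_simp] at h
  refine Eq.trans (tsum_congr fun k => ?_) (h.trans (by ring))
  rw [thetaCoeff, mul_assoc]
  congr 1
  rw [← zpow_natCast q 6, ← zpow_natCast q 2, ← zpow_mul, ← zpow_mul, ← zpow_add₀ hq0]
  congr 1
  have := two_mul_tri k
  push_cast
  linarith

/-- Θ_q(z²) vanishes at the square roots of powers of q: the roots ±q^k account for Θ_q(z) and
Θ_q(-z), the others for a theta function of z² in base q². The constant term of the last two is the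
pentagonal series. -/
theorem intIndefSum_two {q : ℂ} (hq0 : q ≠ 0) (hq : ‖q‖ < 1) :
    intIndefSum (fun m n => shiftedThetaCoeff q n * q ^ (n * (2 * m)) * shiftedThetaCoeff q m) =
      qPoch q q ^ 2 := by
  have h2 := norm_pow_lt_one hq two_ne_zero
  have hE := qPoch_ne_zero_of_norm_lt hq hq
  have hE2 := qPoch_ne_zero_of_norm_lt h2 h2
  have hT := summable_norm_shiftedThetaCoeff hq0 hq one_ne_zero
  simp only [one_zpow, mul_one] at hT
  have s1 : Summable fun k => ‖thetaCoeff q k * (-q) ^ k‖ :=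
    summable_norm_thetaCoeff hq0 hq (neg_ne_zero.mpr hq0)
  have s2 : Summable fun k => ‖evenExtend (fun k => thetaCoeff (q ^ 2) k * q ^ k) k‖ :=
    summable_norm_evenExtend (summable_norm_thetaCoeff (pow_ne_zero 2 hq0) h2 hq0)
  rw [← intIndefSum_mul_evenExtend (fun m n => shiftedThetaCoeff q n * q ^ (n * m))]
  have key := intIndefSum_of_tsum_eq hq0 hq (v := evenExtend (shiftedThetaCoeff q))
    (r := fun k => (qPoch q q * qPoch (q ^ 2) (q ^ 2))⁻¹ * laurentConv
      (fun k => thetaCoeff q k * (-q) ^ k)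
      (evenExtend fun k => thetaCoeff (q ^ 2) k * q ^ k) k)
    ?_ (summable_norm_evenExtend hT) ?_
  · rw [key, laurentConv, tsum_mul_evenExtend _ (fun N => thetaCoeff q (0 - N) * (-q) ^ (0 - N))]
    have : ∑' k : ℤ, thetaCoeff q (0 - 2 * k) * (-q) ^ (0 - 2 * k) *
        (thetaCoeff (q ^ 2) k * q ^ k) = qPoch (q ^ 2) (q ^ 2) := by
      rw [← tsum_pentagonal hq0 hq]
      refine tsum_congr fun k => ?_
      have e : Even (0 - 2 * k) := ⟨-k, by ring⟩
      have e2 : q ^ tri (0 - 2 * k) * q ^ (0 - 2 * k) * (q ^ 2) ^ tri k * q ^ k =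
          q ^ (3 * k ^ 2 - k) := by
        rw [← zpow_natCast q 2, ← zpow_mul, ← zpow_add₀ hq0, ← zpow_add₀ hq0, ← zpow_add₀ hq0]
        congr 1
        have a1 := two_mul_tri (0 - 2 * k)
        have a2 := two_mul_tri k
        push_cast
        linarith
      rw [thetaCoeff, thetaCoeff, e.neg_zpow, e.neg_zpow, one_zpow]
      linear_combination (-1 : ℂ) ^ k * e2
    rw [this]
    field_simp
  · simp_rw [norm_mul (qPoch q q * _)⁻¹]
    exact (summable_norm_laurentConv s1 s2).mul_left _
  · intro z hz
    have hz0 := ne_zero_of_norm_eq_one hz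
    have hz2 := pow_ne_zero 2 hz0
    simp_rw [mul_assoc (qPoch q q * _)⁻¹]
    rw [tsum_mul_left, tsum_laurentConv s1 s2 hz, tsum_evenExtend, tsum_evenExtend,
      tsum_thetaCoeff_mul_pow hq0 hq (neg_ne_zero.mpr hq0) hz0,
      tsum_thetaCoeff_mul_pow (pow_ne_zero 2 hq0) h2 hq0 hz2,
      tsum_shiftedThetaCoeff hq0 hq hz2, qPoch_split_two (z ^ 2 * q) hq, qPoch_split_two (z ^ 2)⁻¹ hq,
      show z ^ 2 * q * q = (z * q) ^ 2 by ring, ← inv_pow, ← qPoch_mul_qPoch_neg _ hq,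
      ← qPoch_mul_qPoch_neg _ hq, show -q * z = -(z * q) by ring,
      show q / -(z * q) = -z⁻¹ by field_simp, show q ^ 2 / (q * z ^ 2) = z⁻¹ ^ 2 * q by field_simp,
      mul_comm q (z ^ 2)]
    field_simp

/-! ### From rational lattices to integer indices -/

/-- The points `(α i + β, γ j + δ)` for integers `i` and `j`. -/
def affineLattice (α β γ δ : ℚ) : Set (ℚ × ℚ) :=
  Set.range fun x : ℤ × ℤ => (α * x.1 + β, γ * x.2 + δ)

/-- The offset must lie in [0, α) for the sign of a lattice coordinate to agree with that of its
index; hence the normalization of the offsets throughout. -/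
theorem affine_nonneg_iff {α β : ℚ} (h0 : 0 ≤ β) (h1 : β < α) (i : ℤ) :
    0 ≤ α * i + β ↔ 0 ≤ i := by
  constructor
  · intro h
    by_contra hi
    have : (i : ℚ) ≤ -1 := by exact_mod_cast (by omega : i ≤ -1)
    nlinarith
  · intro h
    have : (0 : ℚ) ≤ i := by exact_mod_cast h
    have := mul_nonneg (h0.trans h1.le) this
    linarith

theorem posPart_affineLattice {α β γ δ : ℚ} (hβ : 0 ≤ β) (hα : β < α) (hδ : 0 ≤ δ) (hγ : δ < γ) :
    posPart (affineLattice α β γ δ) =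
      Set.range fun x : ℕ × ℕ => (α * (x.1 : ℤ) + β, γ * (x.2 : ℤ) + δ) := by
  ext x
  constructor
  · rintro ⟨⟨⟨i, j⟩, rfl⟩, h1, h2⟩
    lift i to ℕ using (affine_nonneg_iff hβ hα i).mp h1
    lift j to ℕ using (affine_nonneg_iff hδ hγ j).mp h2
    exact ⟨(i, j), rfl⟩
  · rintro ⟨⟨i, j⟩, rfl⟩
    exact ⟨⟨(i, j), rfl⟩, (affine_nonneg_iff hβ hα i).mpr (Int.natCast_nonneg i),
      (affine_nonneg_iff hδ hγ j).mpr (Int.natCast_nonneg j)⟩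

theorem negPart_affineLattice {α β γ δ : ℚ} (hβ : 0 ≤ β) (hα : β < α) (hδ : 0 ≤ δ) (hγ : δ < γ) :
    negPart (affineLattice α β γ δ) = Set.range fun x : ℕ × ℕ =>
      (α * (-(x.1 + 1) : ℤ) + β, γ * (-(x.2 + 1) : ℤ) + δ) := by
  ext x
  constructor
  · rintro ⟨⟨⟨i, j⟩, rfl⟩, h1, h2⟩
    have hi := mt (affine_nonneg_iff hβ hα i).mpr (not_le.mpr h1)
    have hj := mt (affine_nonneg_iff hδ hγ j).mpr (not_le.mpr h2)
    obtain ⟨i', rfl⟩ : ∃ i' : ℕ, i = -(i' + 1) := ⟨(-i - 1).toNat, by omega⟩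
    obtain ⟨j', rfl⟩ : ∃ j' : ℕ, j = -(j' + 1) := ⟨(-j - 1).toNat, by omega⟩
    exact ⟨(i', j'), rfl⟩
  · rintro ⟨⟨i, j⟩, rfl⟩
    refine ⟨⟨(-(i + 1), -(j + 1)), rfl⟩, ?_, ?_⟩
    · exact not_le.mp (mt (affine_nonneg_iff hβ hα _).mp (by omega))
    · exact not_le.mp (mt (affine_nonneg_iff hδ hγ _).mp (by omega))

theorem injective_affine {α β γ δ : ℚ} (hα : α ≠ 0) (hγ : γ ≠ 0) {e : ℕ → ℤ}
    (he : Function.Injective e) :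
    Function.Injective fun x : ℕ × ℕ => (α * (e x.1 : ℚ) + β, γ * (e x.2 : ℚ) + δ) := by
  rintro ⟨i, j⟩ ⟨i', j'⟩ h
  simp only [Prod.mk.injEq, add_left_inj, mul_right_inj' hα, mul_right_inj' hγ, Int.cast_inj] at h
  rw [he h.1, he h.2]

theorem indefSum_affineLattice {α β γ δ : ℚ} (hβ : 0 ≤ β) (hα : β < α) (hδ : 0 ≤ δ) (hγ : δ < γ)
    {a : ℚ → ℚ → ℂ} {F : ℤ → ℤ → ℂ} (hF : IntIndefSummable F)
    (ha : ∀ i j : ℤ, a (α * i + β) (γ * j + δ) = F i j) :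
    IndefSummable (affineLattice α β γ δ) a ∧
      indefSum (affineLattice α β γ δ) a = intIndefSum F := by
  have hp : HasSum (fun x : posPart (affineLattice α β γ δ) => a x.1.1 x.1.2)
      (∑' x : ℕ × ℕ, F x.1 x.2) := by
    rw [posPart_affineLattice hβ hα hδ hγ]
    refine (Function.Injective.hasSum_range_iff (injective_affine (hβ.trans_lt hα).ne'
      (hδ.trans_lt hγ).ne' Nat.cast_injective) (f := fun x : ℚ × ℚ => a x.1 x.2)).mpr ?_
    exact hF.1.hasSum.congr_fun fun x => ha _ _
  have hn : HasSum (fun x : negPart (affineLattice α β γ δ) => a x.1.1 x.1.2)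
      (∑' x : ℕ × ℕ, F (-(x.1 + 1)) (-(x.2 + 1))) := by
    rw [negPart_affineLattice hβ hα hδ hγ]
    refine (Function.Injective.hasSum_range_iff (injective_affine (hβ.trans_lt hα).ne'
      (hδ.trans_lt hγ).ne' injective_neg_natCast_add_one)
      (f := fun x : ℚ × ℚ => a x.1 x.2)).mpr ?_
    exact hF.2.hasSum.congr_fun fun x => ha _ _
  exact ⟨⟨hp.summable, hn.summable⟩, by rw [indefSum, hp.tsum_eq, hn.tsum_eq, intIndefSum]⟩

theorem indefSum_union {S T : Set (ℚ × ℚ)} (hST : Disjoint S T) {a : ℚ → ℚ → ℂ}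
    (hS : IndefSummable S a) (hT : IndefSummable T a) :
    IndefSummable (S ∪ T) a ∧ indefSum (S ∪ T) a = indefSum S a + indefSum T a := by
  have ep : _root_.posPart (S ∪ T) = _root_.posPart S ∪ _root_.posPart T :=
    Set.ext fun x => ⟨fun h => h.1.imp (⟨·, h.2⟩) (⟨·, h.2⟩),
      fun h => h.elim (fun h => ⟨.inl h.1, h.2⟩) (fun h => ⟨.inr h.1, h.2⟩)⟩
  have en : _root_.negPart (S ∪ T) = _root_.negPart S ∪ _root_.negPart T :=
    Set.ext fun x => ⟨fun h => h.1.imp (⟨·, h.2⟩) (⟨·, h.2⟩),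
      fun h => h.elim (fun h => ⟨.inl h.1, h.2⟩) (fun h => ⟨.inr h.1, h.2⟩)⟩
  have dp : Disjoint (posPart S) (posPart T) := hST.mono (fun x h => h.1) (fun x h => h.1)
  have dn : Disjoint (negPart S) (negPart T) := hST.mono (fun x h => h.1) (fun x h => h.1)
  have hp : HasSum (fun x : posPart (S ∪ T) => a x.1.1 x.1.2)
      ((∑' x : posPart S, a x.1.1 x.1.2) + ∑' x : posPart T, a x.1.1 x.1.2) := by
    rw [ep]
    exact HasSum.add_disjoint (f := fun x : ℚ × ℚ => a x.1 x.2) dp hS.1.hasSum hT.1.hasSum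
  have hn : HasSum (fun x : negPart (S ∪ T) => a x.1.1 x.1.2)
      ((∑' x : negPart S, a x.1.1 x.1.2) + ∑' x : negPart T, a x.1.1 x.1.2) := by
    rw [en]
    exact HasSum.add_disjoint (f := fun x : ℚ × ℚ => a x.1 x.2) dn hS.2.hasSum hT.2.hasSum
  refine ⟨⟨hp.summable, hn.summable⟩, ?_⟩
  rw [indefSum, hp.tsum_eq, hn.tsum_eq, indefSum, indefSum]
  ring

theorem latticeZZ_eq : latticeZZ = affineLattice 1 0 1 0 := by
  ext x
  simp [latticeZZ, affineLattice, eq_comm]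

theorem latticeHalfLeft_eq : latticeHalfLeft = affineLattice 1 (1 / 2) 1 0 := by
  ext x
  simp [latticeHalfLeft, affineLattice, eq_comm]

theorem latticeHalfRight_eq : latticeHalfRight = affineLattice 1 0 1 (1 / 2) := by
  ext x
  simp [latticeHalfRight, affineLattice, eq_comm]

theorem latticeOdd_eq : latticeOdd = affineLattice 2 1 2 0 ∪ affineLattice 2 0 2 1 := by
  ext x
  constructor
  · rintro ⟨i, j, hij, rfl⟩
    rcases Int.even_or_odd' j with ⟨b, rfl | rfl⟩
    · obtain ⟨a, rfl⟩ : ∃ a, i = 2 * a + 1 := ⟨i / 2, by rw [Int.ModEq] at hij; omega⟩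
      exact Or.inl ⟨(a, b), by simp⟩
    · obtain ⟨a, rfl⟩ : ∃ a, i = 2 * a := ⟨i / 2, by rw [Int.ModEq] at hij; omega⟩
      exact Or.inr ⟨(a, b), by simp⟩
  · rintro (⟨⟨a, b⟩, rfl⟩ | ⟨⟨a, b⟩, rfl⟩)
    · exact ⟨2 * a + 1, 2 * b, by rw [Int.ModEq]; omega, by simp⟩
    · exact ⟨2 * a, 2 * b + 1, by rw [Int.ModEq]; omega, by simp⟩

theorem disjoint_affineLattice_odd : Disjoint (affineLattice 2 1 2 0) (affineLattice 2 0 2 1) := by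
  rw [Set.disjoint_left]
  rintro x ⟨⟨a, b⟩, rfl⟩ ⟨⟨c, d⟩, h⟩
  have h1 := congrArg Prod.fst h
  simp only at h1
  have h2 : 2 * c = 2 * a + 1 := by
    have : (2 : ℚ) * c = 2 * a + 1 := by linarith
    exact_mod_cast this
  omega

/-! ### Evaluation of the four indefinite sums -/

theorem qPow_add (τ : ℍ) (x y : ℚ) : qPow τ (x + y) = qPow τ x * qPow τ y := by
  rw [qPow, qPow, qPow, ← Complex.exp_add]
  congr 1
  push_cast
  ring

theorem qPow_ne_zero (τ : ℍ) (x : ℚ) : qPow τ x ≠ 0 := Complex.exp_ne_zero _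

theorem qPow_intCast (τ : ℍ) (k : ℤ) : qPow τ k = qPow τ 1 ^ k := by
  rw [qPow, qPow, ← Complex.exp_int_mul]
  congr 1
  push_cast
  ring

theorem qPow_natCast (τ : ℍ) (k : ℕ) : qPow τ k = qPow τ 1 ^ k := by
  have := qPow_intCast τ k
  rwa [Int.cast_natCast, zpow_natCast] at this

theorem norm_qPow_one_lt (τ : ℍ) : ‖qPow τ 1‖ < 1 := by
  have := UpperHalfPlane.norm_exp_two_pi_I_lt_one τ
  simpa [qPow] using this

theorem intIndefSum_const_mul (c : ℂ) (F : ℤ → ℤ → ℂ) :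
    intIndefSum (fun m n => c * F m n) = c * intIndefSum F := by
  rw [intIndefSum, intIndefSum, tsum_mul_left, tsum_mul_left, mul_sub]

theorem IntIndefSummable.const_mul {F : ℤ → ℤ → ℂ} (h : IntIndefSummable F) (c : ℂ) :
    IntIndefSummable fun m n => c * F m n :=
  ⟨h.1.mul_left c, h.2.mul_left c⟩

theorem cast_tri (k : ℤ) : ((tri k : ℤ) : ℚ) = k * (k - 1) / 2 := by
  have : (2 : ℚ) * (tri k : ℤ) = k * (k - 1) := by exact_mod_cast two_mul_tri k
  linarith

theorem shiftedThetaCoeff_term {p : ℂ} (hp : p ≠ 0) (s : ℕ) (m n : ℤ) :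
    shiftedThetaCoeff (p ^ 3) n * (p ^ 3) ^ (n * m) * (shiftedThetaCoeff p m * (p ^ s) ^ m) =
      (-1) ^ (m + n) * p ^ (3 * tri (n + 1) + 3 * (n * m) + tri (m + 1) + s * m) := by
  rw [shiftedThetaCoeff, shiftedThetaCoeff, ← zpow_natCast p 3, ← zpow_natCast p s, ← zpow_mul,
    ← zpow_mul, ← zpow_mul, zpow_add₀ hp, zpow_add₀ hp, zpow_add₀ hp, zpow_add₀ (by norm_num)]
  push_cast
  ring

/-- Dictionary between the quadratic form and theta coefficients: d rescales q (d = 4 for the parity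
cosets), s is the extra linear term in m, and c is the value of the form at the offset of the coset.
-/
theorem qPow_term (τ : ℍ) (d s : ℕ) (c : ℚ) {x : ℚ} {m n : ℤ}
    (hx : x = c + d * (3 * ((n + 1) * n / 2) + 3 * (n * m) + (m + 1) * m / 2 + s * m)) :
    (-1) ^ (m + n) * qPow τ x = qPow τ c *
      (shiftedThetaCoeff ((qPow τ 1 ^ d) ^ 3) n * ((qPow τ 1 ^ d) ^ 3) ^ (n * m) *
        (shiftedThetaCoeff (qPow τ 1 ^ d) m * ((qPow τ 1 ^ d) ^ s) ^ m)) := by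
  rw [shiftedThetaCoeff_term (pow_ne_zero d (qPow_ne_zero τ 1)), ← zpow_natCast (qPow τ 1) d,
    ← zpow_mul, ← qPow_intCast, mul_left_comm, ← qPow_add, hx]
  congr 3
  push_cast
  rw [cast_tri, cast_tri]
  push_cast
  ring

theorem summable_intIndef_three {p : ℂ} (hp0 : p ≠ 0) (hp : ‖p‖ < 1) (s : ℕ) :
    IntIndefSummable fun m n => shiftedThetaCoeff (p ^ 3) n * (p ^ 3) ^ (n * m) *
      (shiftedThetaCoeff p m * (p ^ s) ^ m) :=
  intIndefSummable_mul_coeff (pow_ne_zero 3 hp0) (norm_pow_lt_one hp three_ne_zero)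
    (summable_norm_shiftedThetaCoeff hp0 hp (pow_ne_zero s hp0))

theorem indefSum_latticeHalfLeft (τ : ℍ) :
    IndefSummable latticeHalfLeft (fun m n =>
        negOnePow (m + n - 1 / 2) * qPow τ ((m ^ 2 + 6 * m * n + 3 * n ^ 2) / 2)) ∧
      indefSum latticeHalfLeft (fun m n =>
        negOnePow (m + n - 1 / 2) * qPow τ ((m ^ 2 + 6 * m * n + 3 * n ^ 2) / 2)) =
        qPow τ (1 / 8) * (qPoch (qPow τ 1) (qPow τ 1) *
          ∑' N : ℤ, (qPow τ 1 ^ 3) ^ (N ^ 2) * qPow τ 1 ^ N) := by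
  have h0 := qPow_ne_zero τ 1
  have h1 := norm_qPow_one_lt τ
  rw [← intIndefSum_halfLeft h0 h1, ← intIndefSum_const_mul, latticeHalfLeft_eq]
  refine indefSum_affineLattice (by norm_num) (by norm_num) le_rfl one_pos
    ((summable_intIndef_three h0 h1 0).const_mul _) fun i j => ?_
  have e : (1 : ℚ) * i + 1 / 2 + (1 * j + 0) - 1 / 2 = ((i + j : ℤ) : ℚ) := by push_cast; ring
  rw [e, negOnePow_intCast, qPow_term τ 1 0 (1 / 8) (by push_cast; ring), pow_one]

theorem indefSum_latticeHalfRight (τ : ℍ) :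
    IndefSummable latticeHalfRight (fun m n =>
        negOnePow (m + n - 1 / 2) * qPow τ ((m ^ 2 + 6 * m * n + 3 * n ^ 2) / 2)) ∧
      indefSum latticeHalfRight (fun m n =>
        negOnePow (m + n - 1 / 2) * qPow τ ((m ^ 2 + 6 * m * n + 3 * n ^ 2) / 2)) =
        qPow τ (3 / 8) * (qPoch (qPow τ 1) (qPow τ 1) *
          ∑' N : ℤ, (qPow τ 1 ^ 3) ^ (N ^ 2) * (qPow τ 1 ^ 2) ^ N) := by
  have h0 := qPow_ne_zero τ 1
  have h1 := norm_qPow_one_lt τ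
  rw [← intIndefSum_halfRight h0 h1, ← intIndefSum_const_mul, latticeHalfRight_eq]
  refine indefSum_affineLattice le_rfl one_pos (by norm_num) (by norm_num)
    ((summable_intIndef_three h0 h1 1).const_mul _) fun i j => ?_
  have e : (1 : ℚ) * i + 0 + (1 * j + 1 / 2) - 1 / 2 = ((i + j : ℤ) : ℚ) := by push_cast; ring
  rw [e, negOnePow_intCast, qPow_term τ 1 1 (3 / 8) (by push_cast; ring)]
  simp only [pow_one]

theorem indefSum_latticeZZ (τ : ℍ) :
    IndefSummable latticeZZ (fun m n =>
        negOnePow (m + n) * qPow τ (2 * m * n + (m ^ 2 + m) / 2 + (n ^ 2 + n) / 2)) ∧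
      indefSum latticeZZ (fun m n =>
        negOnePow (m + n) * qPow τ (2 * m * n + (m ^ 2 + m) / 2 + (n ^ 2 + n) / 2)) =
        qPoch (qPow τ 1) (qPow τ 1) ^ 2 := by
  have h0 := qPow_ne_zero τ 1
  have h1 := norm_qPow_one_lt τ
  have hT := summable_norm_shiftedThetaCoeff h0 h1 one_ne_zero
  simp only [one_zpow, mul_one] at hT
  rw [← intIndefSum_two h0 h1, latticeZZ_eq]
  refine indefSum_affineLattice le_rfl one_pos le_rfl one_pos
    (.of_norm_le hT hT fun m n hmn => ?_) fun i j => ?_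
  · rw [norm_mul, norm_mul, mul_comm ‖shiftedThetaCoeff (qPow τ 1) m‖]
    gcongr
    exact mul_le_of_le_one_right (norm_nonneg _) (norm_zpow_le_one h1 (by nlinarith))
  · have e : (1 : ℚ) * i + 0 + (1 * j + 0) = ((i + j : ℤ) : ℚ) := by push_cast; ring
    have e2 : qPow τ 1 ^ tri (j + 1) * qPow τ 1 ^ (j * (2 * i)) * qPow τ 1 ^ tri (i + 1) =
        qPow τ (2 * (1 * i + 0) * (1 * j + 0) + ((1 * i + 0) ^ 2 + (1 * i + 0)) / 2 +
          ((1 * j + 0) ^ 2 + (1 * j + 0)) / 2) := by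
      rw [← zpow_add₀ h0, ← zpow_add₀ h0, ← qPow_intCast]
      congr 1
      push_cast
      rw [cast_tri, cast_tri]
      push_cast
      ring
    rw [e, negOnePow_intCast, ← e2, zpow_add₀ (by norm_num), shiftedThetaCoeff, shiftedThetaCoeff]
    ring

/-- 3N² = 6 N(N-1)/2 + 3N, which puts the series in the shape of the triple product in base p⁶. -/
theorem pow_sq_mul_eq_thetaCoeff {p : ℂ} (hp0 : p ≠ 0) (y : ℂ) (N : ℤ) :
    (p ^ 3) ^ (N ^ 2) * y ^ N = thetaCoeff (p ^ 6) N * (-(p ^ 3 * y)) ^ N := by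
  have e : (p ^ 3) ^ (N ^ 2) = (p ^ 6) ^ tri N * (p ^ 3) ^ N := by
    rw [← zpow_natCast p 3, ← zpow_natCast p 6, ← zpow_mul, ← zpow_mul, ← zpow_mul,
      ← zpow_add₀ hp0]
    congr 1
    have := two_mul_tri N
    push_cast
    linarith
  have e2 : (-1 : ℂ) ^ N * (-1) ^ N = 1 := by rw [← mul_zpow]; simp
  rw [e, thetaCoeff, ← neg_one_mul (p ^ 3 * y), mul_zpow, mul_zpow]
  linear_combination (-((p ^ 6) ^ tri N * (p ^ 3) ^ N * y ^ N)) * e2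

theorem summable_pow_sq_mul {p : ℂ} (hp0 : p ≠ 0) (hp : ‖p‖ < 1) {y : ℂ} (hy : y ≠ 0) :
    Summable fun N : ℤ => (p ^ 3) ^ (N ^ 2) * y ^ N :=
  (summable_norm_thetaCoeff (pow_ne_zero 6 hp0) (norm_pow_lt_one hp (by norm_num))
    (neg_ne_zero.mpr (mul_ne_zero (pow_ne_zero 3 hp0) hy))).of_norm.congr fun N =>
      (pow_sq_mul_eq_thetaCoeff hp0 y N).symm

theorem tsum_pow_sq_mul {p : ℂ} (hp0 : p ≠ 0) (hp : ‖p‖ < 1) {y : ℂ} (hy : y ≠ 0) :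
    ∑' N : ℤ, (p ^ 3) ^ (N ^ 2) * y ^ N =
      qPoch (p ^ 6) (p ^ 6) * qPoch (-(p ^ 3 * y)) (p ^ 6) * qPoch (-(p ^ 3 / y)) (p ^ 6) := by
  have h := jacobi_triple_product (pow_ne_zero 6 hp0) (norm_pow_lt_one hp (m := 6) (by norm_num))
    (neg_ne_zero.mpr (mul_ne_zero (pow_ne_zero 3 hp0) hy))
  rw [show p ^ 6 / -(p ^ 3 * y) = -(p ^ 3 / y) by field_simp] at h
  rw [← h]
  exact tsum_congr fun N => pow_sq_mul_eq_thetaCoeff hp0 y N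

theorem tsum_int_even_odd {f : ℤ → ℂ} (hf : Summable f) :
    -- The odd integers are parametrized as -(2N+1) so that 3k² + 2k becomes 12N² + 8N + 1, the
    -- exponent of the second parity coset.
    ∑' k, f k = ∑' N : ℤ, f (2 * N) + ∑' N : ℤ, f (-(2 * N + 1)) := by
  have hodd : Function.Injective fun N : ℤ => -(2 * N + 1) := fun a b h => by simpa using h
  have hc : IsCompl (Set.range fun N : ℤ => 2 * N) (Set.range fun N : ℤ => -(2 * N + 1)) := by
    refine ⟨Set.disjoint_left.mpr ?_, codisjoint_iff.mpr (Set.eq_univ_of_forall fun k => ?_)⟩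
    · rintro _ ⟨a, rfl⟩ ⟨b, h⟩
      simp only at h
      omega
    · rcases Int.even_or_odd' k with ⟨b, rfl | rfl⟩
      · exact Or.inl ⟨b, rfl⟩
      · exact Or.inr ⟨-b - 1, by simp only; ring⟩
  refine (HasSum.add_isCompl hc ?_ ?_).tsum_eq
  · exact injective_two_mul.hasSum_range_iff.mpr
      (hf.comp_injective injective_two_mul).hasSum
  · exact hodd.hasSum_range_iff.mpr (hf.comp_injective hodd).hasSum

theorem indefSum_latticeOdd (τ : ℍ) :
    IndefSummable latticeOdd (fun m n =>
        negOnePow ((m + n - 1) / 2) * qPow τ ((m ^ 2 + 6 * m * n + 3 * n ^ 2) / 2)) ∧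
      indefSum latticeOdd (fun m n =>
        negOnePow ((m + n - 1) / 2) * qPow τ ((m ^ 2 + 6 * m * n + 3 * n ^ 2) / 2)) =
        qPow τ (1 / 2) * (qPoch (qPow τ 1 ^ 4) (qPow τ 1 ^ 4) *
          ∑' N : ℤ, (qPow τ 1 ^ 3) ^ (N ^ 2) * (qPow τ 1 ^ 2) ^ N) := by
  have h0 := qPow_ne_zero τ 1
  have h1 := norm_qPow_one_lt τ
  have h40 := pow_ne_zero 4 h0
  have h41 := norm_pow_lt_one h1 four_ne_zero
  have hA := indefSum_affineLattice (α := 2) (β := 1) (γ := 2) (δ := 0) (by norm_num) (by norm_num)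
    le_rfl two_pos (a := fun m n =>
        negOnePow ((m + n - 1) / 2) * qPow τ ((m ^ 2 + 6 * m * n + 3 * n ^ 2) / 2))
    ((summable_intIndef_three h40 h41 0).const_mul (qPow τ (1 / 2))) fun i j => by
      have e : ((2 : ℚ) * i + 1 + (2 * j + 0) - 1) / 2 = ((i + j : ℤ) : ℚ) := by push_cast; ring
      rw [e, negOnePow_intCast, qPow_term τ 4 0 (1 / 2) (by push_cast; ring)]
  have hB := indefSum_affineLattice (α := 2) (β := 0) (γ := 2) (δ := 1) le_rfl two_pos
    (by norm_num) (by norm_num) (a := fun m n =>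
        negOnePow ((m + n - 1) / 2) * qPow τ ((m ^ 2 + 6 * m * n + 3 * n ^ 2) / 2))
    ((summable_intIndef_three h40 h41 1).const_mul (qPow τ (3 / 2))) fun i j => by
      have e : ((2 : ℚ) * i + 0 + (2 * j + 1) - 1) / 2 = ((i + j : ℤ) : ℚ) := by push_cast; ring
      rw [e, negOnePow_intCast, qPow_term τ 4 1 (3 / 2) (by push_cast; ring)]
  obtain ⟨hs, he⟩ := indefSum_union disjoint_affineLattice_odd hA.1 hB.1
  rw [latticeOdd_eq]
  refine ⟨hs, ?_⟩
  rw [he, hA.2, hB.2, intIndefSum_const_mul, intIndefSum_const_mul, intIndefSum_halfLeft h40 h41,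
    intIndefSum_halfRight h40 h41,
    tsum_int_even_odd (summable_pow_sq_mul h0 h1 (pow_ne_zero 2 h0)),
    -- The surplus factor q of the second coset supplies the constant 1 in the exponent 12N² + 8N +
    -- 1.
    show (3 / 2 : ℚ) = 1 / 2 + 1 by norm_num, qPow_add]
  have e1 : ∑' N : ℤ, ((qPow τ 1 ^ 4) ^ 3) ^ (N ^ 2) * (qPow τ 1 ^ 4) ^ N =
      ∑' N : ℤ, (qPow τ 1 ^ 3) ^ ((2 * N) ^ 2) * (qPow τ 1 ^ 2) ^ (2 * N) := by
    refine tsum_congr fun N => ?_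
    simp only [← pow_mul]
    simp only [← zpow_natCast (qPow τ 1), ← zpow_mul, ← zpow_add₀ h0]
    congr 1
    push_cast
    ring
  have e2 : qPow τ 1 * ∑' N : ℤ, ((qPow τ 1 ^ 4) ^ 3) ^ (N ^ 2) * ((qPow τ 1 ^ 4) ^ 2) ^ N =
      ∑' N : ℤ, (qPow τ 1 ^ 3) ^ ((-(2 * N + 1)) ^ 2) * (qPow τ 1 ^ 2) ^ (-(2 * N + 1)) := by
    rw [← tsum_mul_left]
    refine tsum_congr fun N => ?_
    simp only [← pow_mul]
    simp only [← zpow_natCast (qPow τ 1), ← zpow_mul, ← zpow_add₀ h0, ← zpow_one_add₀ h0]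
    congr 1
    push_cast
    ring
  rw [e1, ← e2]
  ring

/-! ### Product forms of the resulting theta series -/

/-- Euler's identity `∏ (1 + q ^ n) (1 - q ^ (2 n - 1)) = 1`. -/
theorem qPoch_neg_mul_qPoch_sq {q : ℂ} (hq : ‖q‖ < 1) : qPoch (-q) q * qPoch q (q ^ 2) = 1 := by
  have h2 := norm_pow_lt_one hq two_ne_zero
  have h := qPoch_mul_qPoch_neg q hq
  rw [qPoch_split_two q hq, ← sq] at h
  have hE := qPoch_ne_zero_of_norm_lt h2 h2
  refine mul_left_cancel₀ hE ?_
  linear_combination h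

theorem qPoch_pow_six {q : ℂ} (hq : ‖q‖ < 1) :
    qPoch (q ^ 6) (q ^ 6) =
      qPoch (-q ^ 6) (q ^ 6) * qPoch (q ^ 3) (q ^ 3) * qPoch (-q ^ 3) (q ^ 6) := by
  have h3 := norm_pow_lt_one hq three_ne_zero
  have h6 := norm_pow_lt_one hq (m := 6) (by norm_num)
  have a1 := qPoch_split_two (q ^ 3) h3
  have a2 := qPoch_mul_qPoch_neg (q ^ 3) h6
  have a3 := qPoch_neg_mul_qPoch_sq h6
  simp only [← pow_mul, ← pow_add] at a1 a2 a3
  norm_num at a1 a2 a3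
  rw [a1]
  linear_combination (-qPoch (-q ^ 6) (q ^ 6) * qPoch (q ^ 6) (q ^ 6)) * a2 -
    qPoch (q ^ 6) (q ^ 6) * a3

/-- The classes -q² and -q⁴ mod q⁶ are two thirds of (-q²;q²)_∞; the missing (-q⁶;q⁶)_∞ comes from
rewriting (q⁶;q⁶)_∞. -/
theorem theta_product_left {q : ℂ} (hq : ‖q‖ < 1) :
    qPoch (q ^ 6) (q ^ 6) * qPoch (-q ^ 4) (q ^ 6) * qPoch (-q ^ 2) (q ^ 6) =
      qPoch (-q ^ 2) (q ^ 2) * qPoch (q ^ 3) (q ^ 3) * qPoch (-q ^ 3) (q ^ 6) := by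
  have h2 := norm_pow_lt_one hq two_ne_zero
  have a1 := qPoch_split_three (-q ^ 2) h2
  simp only [← pow_mul, neg_mul, ← pow_add] at a1
  norm_num at a1
  rw [a1, qPoch_pow_six hq]
  ring

theorem theta_product_right {q : ℂ} (hq : ‖q‖ < 1) :
    qPoch (q ^ 6) (q ^ 6) * qPoch (-q ^ 5) (q ^ 6) * qPoch (-q) (q ^ 6) =
      qPoch (-q) (q ^ 2) * qPoch (q ^ 3) (q ^ 3) * qPoch (-q ^ 6) (q ^ 6) := by
  have h2 := norm_pow_lt_one hq two_ne_zero
  have a1 := qPoch_split_three (-q) h2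
  simp only [← pow_mul, neg_mul, ← pow_succ'] at a1
  norm_num at a1
  rw [a1, qPoch_pow_six hq]
  ring

theorem qPoch_four_mul {q : ℂ} (hq : ‖q‖ < 1) :
    qPoch (q ^ 4) (q ^ 4) * qPoch (-q) (q ^ 2) = qPoch (-q) q * qPoch (q ^ 2) (q ^ 2) := by
  have h2 := norm_pow_lt_one hq two_ne_zero
  have a1 := qPoch_mul_qPoch_neg (q ^ 2) h2
  have a2 := qPoch_split_two (-q) hq
  rw [neg_mul, ← sq] at a2
  rw [← pow_mul] at a1
  rw [a2, ← a1]
  ring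

theorem tsum_pow_sq_mul_self {q : ℂ} (hq0 : q ≠ 0) (hq : ‖q‖ < 1) :
    ∑' N : ℤ, (q ^ 3) ^ (N ^ 2) * q ^ N =
      qPoch (-q ^ 2) (q ^ 2) * qPoch (q ^ 3) (q ^ 3) * qPoch (-q ^ 3) (q ^ 6) := by
  rw [tsum_pow_sq_mul hq0 hq hq0, ← theta_product_left hq, ← pow_succ,
    show q ^ 3 / q = q ^ 2 by field_simp]

theorem tsum_pow_sq_mul_sq {q : ℂ} (hq0 : q ≠ 0) (hq : ‖q‖ < 1) :
    ∑' N : ℤ, (q ^ 3) ^ (N ^ 2) * (q ^ 2) ^ N =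
      qPoch (-q) (q ^ 2) * qPoch (q ^ 3) (q ^ 3) * qPoch (-q ^ 6) (q ^ 6) := by
  rw [tsum_pow_sq_mul hq0 hq (pow_ne_zero 2 hq0), ← theta_product_right hq, ← pow_add,
    show q ^ 3 / q ^ 2 = q by field_simp]

/-! ### Theta and eta values as infinite products -/

theorem thetaChar_eq_qPoch (c : ℚ) (z : ℂ) {t : ℂ} (ht : 0 < t.im) :
    thetaChar c z t = cexp (π * I * t * (c : ℂ) ^ 2 + 2 * π * I * (c : ℂ) * z) *
      (qPoch (cexp (2 * π * I * t)) (cexp (2 * π * I * t)) *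
        qPoch (-cexp (π * I * t + 2 * π * I * (z + c * t))) (cexp (2 * π * I * t)) *
        qPoch (-cexp (π * I * t - 2 * π * I * (z + c * t))) (cexp (2 * π * I * t))) := by
  have hQ : ‖cexp (2 * π * I * t)‖ < 1 := UpperHalfPlane.norm_exp_two_pi_I_lt_one ⟨t, ht⟩
  have h := jacobi_triple_product (Complex.exp_ne_zero _) hQ
    (neg_ne_zero.mpr (Complex.exp_ne_zero (π * I * t + 2 * π * I * (z + c * t))))
  rw [div_neg, ← Complex.exp_sub, show 2 * π * I * t - (π * I * t + 2 * π * I * (z + c * t)) =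
    π * I * t - 2 * π * I * (z + c * t) by ring] at h
  rw [← h, thetaChar, ← tsum_mul_left]
  refine tsum_congr fun n => ?_
  have e2 : (-1 : ℂ) ^ n * (-1) ^ n = 1 := by rw [← mul_zpow]; simp
  have e3 : (2 : ℂ) * (tri n : ℤ) = n * (n - 1) := by exact_mod_cast two_mul_tri n
  rw [thetaCoeff, ← neg_one_mul (cexp (π * I * t + _)), mul_zpow, mul_mul_mul_comm, e2, one_mul,
    ← Complex.exp_int_mul, ← Complex.exp_int_mul, ← Complex.exp_add, ← Complex.exp_add]
  congr 1
  linear_combination (-π * I * t) * e3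

theorem exp_pi_mul_I_div_two : cexp (2 * π * I * (1 / 4)) = I := by
  rw [show 2 * (π : ℂ) * I * (1 / 4) = π / 2 * I by ring, exp_pi_div_two_mul_I]

/-- At z = 1/4 the two products have arguments ±i times powers of Q; splitting off the factor 1 - i
aligns them, and they multiply to a product in Q². The constant e^(πi/4)(1 - i) later cancels
between numerator and denominator. -/
theorem thetaChar_half_quarter {t : ℂ} (ht : 0 < t.im) :
    thetaChar (1 / 2) (1 / 4) t = cexp (π * I / 4) * (1 - I) * cexp (2 * π * I * t * (1 / 8)) *
      (qPoch (cexp (2 * π * I * t)) (cexp (2 * π * I * t)) *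
        qPoch (-cexp (2 * π * I * t) ^ 2) (cexp (2 * π * I * t) ^ 2)) := by
  have hQ : ‖cexp (2 * π * I * t)‖ < 1 := UpperHalfPlane.norm_exp_two_pi_I_lt_one ⟨t, ht⟩
  have e1 : π * I * t + 2 * π * I * (1 / 4 + ((1 / 2 : ℚ) : ℂ) * t) =
      2 * π * I * (1 / 4) + 2 * π * I * t := by push_cast; ring
  have e2 : π * I * t - 2 * π * I * (1 / 4 + ((1 / 2 : ℚ) : ℂ) * t) =
      -(2 * π * I * (1 / 4)) := by push_cast; ring
  have e3 : π * I * t * ((1 / 2 : ℚ) : ℂ) ^ 2 + 2 * π * I * ((1 / 2 : ℚ) : ℂ) * (1 / 4) =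
      π * I / 4 + 2 * π * I * t * (1 / 8) := by push_cast; ring
  rw [thetaChar_eq_qPoch _ _ ht, e1, e2, e3, Complex.exp_add, Complex.exp_add, Complex.exp_neg,
    exp_pi_mul_I_div_two, inv_I, neg_neg]
  generalize cexp (2 * π * I * t) = Q at *
  have a1 := qPoch_mul_qPoch_neg (I * Q) hQ
  rw [mul_pow, I_sq, neg_one_mul] at a1
  rw [qPoch_eq_one_sub_mul I hQ, ← a1]
  ring

theorem thetaChar_zero_quarter {t : ℂ} (ht : 0 < t.im) :
    thetaChar 0 (1 / 4) t = qPoch (cexp (2 * π * I * t)) (cexp (2 * π * I * t)) *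
        qPoch (-cexp (2 * π * I * t)) (cexp (2 * π * I * t) ^ 2) := by
  have hQ : ‖cexp (2 * π * I * t)‖ < 1 := UpperHalfPlane.norm_exp_two_pi_I_lt_one ⟨t, ht⟩
  have hs : cexp (2 * π * I * t) = cexp (π * I * t) ^ 2 := by
    rw [← Complex.exp_nat_mul]; congr 1; push_cast; ring
  have e1 : π * I * t + 2 * π * I * (1 / 4 + ((0 : ℚ) : ℂ) * t) =
      2 * π * I * (1 / 4) + π * I * t := by push_cast; ring
  have e2 : π * I * t - 2 * π * I * (1 / 4 + ((0 : ℚ) : ℂ) * t) =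
      -(2 * π * I * (1 / 4)) + π * I * t := by push_cast; ring
  have e3 : π * I * t * ((0 : ℚ) : ℂ) ^ 2 + 2 * π * I * ((0 : ℚ) : ℂ) * (1 / 4) = 0 := by
    push_cast; ring
  rw [thetaChar_eq_qPoch _ _ ht, e1, e2, e3, Complex.exp_add, Complex.exp_add, Complex.exp_neg,
    exp_pi_mul_I_div_two, inv_I, Complex.exp_zero, one_mul, mul_assoc]
  have a1 := qPoch_mul_qPoch_neg (I * cexp (π * I * t)) hQ
  rw [mul_pow, I_sq, neg_one_mul, ← hs] at a1
  rw [← a1, neg_mul, neg_neg, mul_comm (qPoch (-(I * _)) _)]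

theorem thetaChar_zero_half {t : ℂ} (ht : 0 < t.im) :
    thetaChar 0 (1 / 2) (4 * t) =
      qPoch (cexp (2 * π * I * t) ^ 4) (cexp (2 * π * I * t) ^ 4) *
        qPoch (cexp (2 * π * I * t) ^ 2) (cexp (2 * π * I * t) ^ 4) ^ 2 := by
  have ht4 : 0 < (4 * t).im := by simpa using ht
  have e0 : cexp (2 * π * I * (4 * t)) = cexp (2 * π * I * t) ^ 4 := by
    rw [← Complex.exp_nat_mul]; congr 1; push_cast; ring
  have e4 : cexp (2 * (2 * π * I * t)) = cexp (2 * π * I * t) ^ 2 := by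
    rw [← Complex.exp_nat_mul]; congr 1
  have e1 : π * I * (4 * t) + 2 * π * I * (1 / 2 + ((0 : ℚ) : ℂ) * (4 * t)) =
      2 * (2 * π * I * t) + π * I := by push_cast; ring
  have e2 : π * I * (4 * t) - 2 * π * I * (1 / 2 + ((0 : ℚ) : ℂ) * (4 * t)) =
      2 * (2 * π * I * t) + -(π * I) := by push_cast; ring
  have e3 : π * I * (4 * t) * ((0 : ℚ) : ℂ) ^ 2 + 2 * π * I * ((0 : ℚ) : ℂ) * (1 / 2) = 0 := by
    push_cast; ring
  rw [thetaChar_eq_qPoch _ _ ht4, e0, e1, e2, e3, Complex.exp_add, Complex.exp_add,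
    Complex.exp_neg, exp_pi_mul_I, e4, Complex.exp_zero]
  norm_num
  ring

theorem thetaChar_quarter_zero {t : ℂ} (ht : 0 < t.im) :
    thetaChar (1 / 4) 0 (4 * t) = cexp (2 * π * I * t * (1 / 8)) *
      (qPoch (cexp (2 * π * I * t) ^ 4) (cexp (2 * π * I * t) ^ 4) *
        qPoch (-cexp (2 * π * I * t)) (cexp (2 * π * I * t) ^ 2)) := by
  have hQ : ‖cexp (2 * π * I * t)‖ < 1 := UpperHalfPlane.norm_exp_two_pi_I_lt_one ⟨t, ht⟩
  have ht4 : 0 < (4 * t).im := by simpa using ht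
  have e0 : cexp (2 * π * I * (4 * t)) = cexp (2 * π * I * t) ^ 4 := by
    rw [← Complex.exp_nat_mul]; congr 1; push_cast; ring
  have e1 : cexp (π * I * (4 * t) + 2 * π * I * (0 + ((1 / 4 : ℚ) : ℂ) * (4 * t))) =
      cexp (2 * π * I * t) ^ 3 := by
    rw [← Complex.exp_nat_mul]; congr 1; push_cast; ring
  have e2 : π * I * (4 * t) - 2 * π * I * (0 + ((1 / 4 : ℚ) : ℂ) * (4 * t)) =
      2 * π * I * t := by push_cast; ring
  have e3 : π * I * (4 * t) * ((1 / 4 : ℚ) : ℂ) ^ 2 + 2 * π * I * ((1 / 4 : ℚ) : ℂ) * 0 =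
      2 * π * I * t * (1 / 8) := by push_cast; ring
  rw [thetaChar_eq_qPoch _ _ ht4, e0, e1, e2, e3]
  generalize cexp (2 * π * I * t) = Q at *
  -- The arguments -Q and -Q³ in base Q⁴ interleave to -Q in base Q².
  have a1 := qPoch_split_two (-Q) (norm_pow_lt_one hQ two_ne_zero)
  rw [← pow_mul, neg_mul, ← pow_succ'] at a1
  norm_num at a1
  rw [a1]
  ring

theorem eta_natCast_mul (τ : ℍ) {d : ℕ} (x : ℚ) (hx : x = d / 24) :
    ModularForm.eta (d * (τ : ℂ)) = qPow τ x * qPoch (qPow τ 1 ^ d) (qPow τ 1 ^ d) := by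
  rw [ModularForm.eta, qPoch]
  congr 1
  · rw [Function.Periodic.qParam, qPow, hx]
    congr 1
    push_cast
    ring
  · refine tprod_congr fun n => ?_
    rw [ModularForm.eta_q_eq_pow, qPow, ← pow_succ', ← pow_mul, ← Complex.exp_nat_mul,
      ← Complex.exp_nat_mul]
    congr 2
    push_cast
    ring

theorem exp_natCast_mul_eq_qPow (τ : ℍ) (d : ℕ) :
    cexp (2 * π * I * (d * (τ : ℂ))) = qPow τ 1 ^ d := by
  rw [qPow, ← Complex.exp_nat_mul]
  congr 1
  push_cast
  ring

theorem exp_eq_qPow_one (τ : ℍ) : cexp (2 * π * I * (τ : ℂ)) = qPow τ 1 := by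
  simpa using exp_natCast_mul_eq_qPow τ 1

theorem exp_mul_eighth_eq_qPow (τ : ℍ) (d : ℕ) (x : ℚ) (hx : x = d / 8) :
    cexp (2 * π * I * (d * (τ : ℂ)) * (1 / 8)) = qPow τ x := by
  rw [qPow, hx]
  congr 1
  push_cast
  ring

theorem thetaChar_half_quarter_natCast_mul (τ : ℍ) {d : ℕ} (hd : d ≠ 0) (x : ℚ) (hx : x = d / 8) :
    thetaChar (1 / 2) (1 / 4) (d * (τ : ℂ)) = cexp (π * I / 4) * (1 - I) * qPow τ x *
      (qPoch (qPow τ 1 ^ d) (qPow τ 1 ^ d) *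
        qPoch (-(qPow τ 1 ^ d) ^ 2) ((qPow τ 1 ^ d) ^ 2)) := by
  have h : 0 < ((d : ℂ) * (τ : ℂ)).im := by
    have := τ.im_pos
    have : (0 : ℝ) < d := by exact_mod_cast Nat.pos_of_ne_zero hd
    simp only [mul_im, natCast_re, natCast_im, zero_mul, add_zero, UpperHalfPlane.coe_im]
    positivity
  rw [thetaChar_half_quarter h, exp_natCast_mul_eq_qPow, exp_mul_eighth_eq_qPow τ d x hx]

theorem thetaChar_zero_quarter_natCast_mul (τ : ℍ) {d : ℕ} (hd : d ≠ 0) :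
    thetaChar 0 (1 / 4) (d * (τ : ℂ)) = qPoch (qPow τ 1 ^ d) (qPow τ 1 ^ d) *
        qPoch (-qPow τ 1 ^ d) ((qPow τ 1 ^ d) ^ 2) := by
  have h : 0 < ((d : ℂ) * (τ : ℂ)).im := by
    have := τ.im_pos
    have : (0 : ℝ) < d := by exact_mod_cast Nat.pos_of_ne_zero hd
    simp only [mul_im, natCast_re, natCast_im, zero_mul, add_zero, UpperHalfPlane.coe_im]
    positivity
  rw [thetaChar_zero_quarter h, exp_natCast_mul_eq_qPow]

theorem one_sub_I_mul_exp_ne_zero : cexp (π * I / 4) * (1 - I) ≠ 0 := by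
  refine mul_ne_zero (Complex.exp_ne_zero _) fun h => ?_
  have := congrArg Complex.re h
  simp at this

/-! ### The fourfold products over positive integers -/

theorem qPow_succ_eq (τ : ℍ) (a d n : ℕ) {x : ℚ} (hx : x = a + d * n) :
    qPow τ x = qPow τ 1 ^ a * (qPow τ 1 ^ d) ^ n := by
  rw [← pow_mul, ← pow_add, ← qPow_natCast, hx]
  push_cast
  rfl

theorem hasProd_pnat_qPoch {F : ℕ → ℂ} {x₁ x₂ x₃ x₄ q₁ q₂ q₃ q₄ : ℂ} (h₁ : ‖q₁‖ < 1)
    (h₂ : ‖q₂‖ < 1) (h₃ : ‖q₃‖ < 1) (h₄ : ‖q₄‖ < 1)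
    (hF : ∀ n : ℕ, F (n + 1) =
      (1 - x₁ * q₁ ^ n) * (1 - x₂ * q₂ ^ n) * (1 - x₃ * q₃ ^ n) * (1 - x₄ * q₄ ^ n)) :
    HasProd (fun n : ℕ+ => F n) (qPoch x₁ q₁ * qPoch x₂ q₂ * qPoch x₃ q₃ * qPoch x₄ q₄) := by
  refine hasProd_pnat_iff_hasProd_succ.mpr ?_
  simp_rw [hF]
  exact ((((multipliable_qPoch x₁ h₁).hasProd.mul (multipliable_qPoch x₂ h₂).hasProd).mul
    (multipliable_qPoch x₃ h₃).hasProd).mul (multipliable_qPoch x₄ h₄).hasProd)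

theorem hasProd_latticeOdd (τ : ℍ) :
    HasProd (fun n : ℕ+ =>
      (1 + qPow τ n) * (1 - qPow τ (2 * n)) * (1 - qPow τ (3 * n)) * (1 + qPow τ (6 * n)))
      (qPoch (-qPow τ 1) (qPow τ 1) * qPoch (qPow τ 1 ^ 2) (qPow τ 1 ^ 2) *
        qPoch (qPow τ 1 ^ 3) (qPow τ 1 ^ 3) * qPoch (-qPow τ 1 ^ 6) (qPow τ 1 ^ 6)) := by
  have h1 := norm_qPow_one_lt τ
  refine hasProd_pnat_qPoch (F := fun n : ℕ =>
    (1 + qPow τ n) * (1 - qPow τ (2 * n)) * (1 - qPow τ (3 * n)) * (1 + qPow τ (6 * n))) h1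
    (norm_pow_lt_one h1 (by norm_num)) (norm_pow_lt_one h1 (by norm_num))
    (norm_pow_lt_one h1 (by norm_num)) fun n => ?_
  rw [qPow_succ_eq τ 1 1 n (x := ((n + 1 : ℕ) : ℚ)) (by push_cast; ring),
    qPow_succ_eq τ 2 2 n (x := 2 * ((n + 1 : ℕ) : ℚ)) (by push_cast; ring),
    qPow_succ_eq τ 3 3 n (x := 3 * ((n + 1 : ℕ) : ℚ)) (by push_cast; ring),
    qPow_succ_eq τ 6 6 n (x := 6 * ((n + 1 : ℕ) : ℚ)) (by push_cast; ring)]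
  ring

theorem hasProd_latticeHalfLeft (τ : ℍ) :
    HasProd (fun n : ℕ+ =>
      (1 - qPow τ n) * (1 + qPow τ (2 * n)) * (1 - qPow τ (3 * n)) * (1 + qPow τ (6 * n - 3)))
      (qPoch (qPow τ 1) (qPow τ 1) * qPoch (-qPow τ 1 ^ 2) (qPow τ 1 ^ 2) *
        qPoch (qPow τ 1 ^ 3) (qPow τ 1 ^ 3) * qPoch (-qPow τ 1 ^ 3) (qPow τ 1 ^ 6)) := by
  have h1 := norm_qPow_one_lt τ
  refine hasProd_pnat_qPoch (F := fun n : ℕ =>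
    (1 - qPow τ n) * (1 + qPow τ (2 * n)) * (1 - qPow τ (3 * n)) * (1 + qPow τ (6 * n - 3))) h1
    (norm_pow_lt_one h1 (by norm_num)) (norm_pow_lt_one h1 (by norm_num))
    (norm_pow_lt_one h1 (by norm_num)) fun n => ?_
  rw [qPow_succ_eq τ 1 1 n (x := ((n + 1 : ℕ) : ℚ)) (by push_cast; ring),
    qPow_succ_eq τ 2 2 n (x := 2 * ((n + 1 : ℕ) : ℚ)) (by push_cast; ring),
    qPow_succ_eq τ 3 3 n (x := 3 * ((n + 1 : ℕ) : ℚ)) (by push_cast; ring),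
    qPow_succ_eq τ 3 6 n (x := 6 * ((n + 1 : ℕ) : ℚ) - 3) (by push_cast; ring)]
  ring

theorem hasProd_latticeHalfRight (τ : ℍ) :
    HasProd (fun n : ℕ+ =>
      (1 - qPow τ n) * (1 + qPow τ (2 * n - 1)) * (1 - qPow τ (3 * n)) * (1 + qPow τ (6 * n)))
      (qPoch (qPow τ 1) (qPow τ 1) * qPoch (-qPow τ 1) (qPow τ 1 ^ 2) *
        qPoch (qPow τ 1 ^ 3) (qPow τ 1 ^ 3) * qPoch (-qPow τ 1 ^ 6) (qPow τ 1 ^ 6)) := by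
  have h1 := norm_qPow_one_lt τ
  refine hasProd_pnat_qPoch (F := fun n : ℕ =>
    (1 - qPow τ n) * (1 + qPow τ (2 * n - 1)) * (1 - qPow τ (3 * n)) * (1 + qPow τ (6 * n))) h1
    (norm_pow_lt_one h1 (by norm_num)) (norm_pow_lt_one h1 (by norm_num))
    (norm_pow_lt_one h1 (by norm_num)) fun n => ?_
  rw [qPow_succ_eq τ 1 1 n (x := ((n + 1 : ℕ) : ℚ)) (by push_cast; ring),
    qPow_succ_eq τ 1 2 n (x := 2 * ((n + 1 : ℕ) : ℚ) - 1) (by push_cast; ring),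
    qPow_succ_eq τ 3 3 n (x := 3 * ((n + 1 : ℕ) : ℚ)) (by push_cast; ring),
    qPow_succ_eq τ 6 6 n (x := 6 * ((n + 1 : ℕ) : ℚ)) (by push_cast; ring)]
  ring

/-! ### Product relations behind the eta-theta quotients -/

theorem qPoch_two_sq {q : ℂ} (hq : ‖q‖ < 1) :
    qPoch (q ^ 2) (q ^ 2) ^ 2 = qPoch (-q) q * (qPoch (q ^ 4) (q ^ 4) *
      qPoch (q ^ 2) (q ^ 4) ^ 2) * (qPoch q q * qPoch (-q ^ 2) (q ^ 2)) := by
  have h2 := norm_pow_lt_one hq two_ne_zero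
  have a1 := qPoch_mul_qPoch_neg q hq
  have a2 := qPoch_neg_mul_qPoch_sq h2
  have a3 := qPoch_split_two (q ^ 2) h2
  simp only [← pow_mul, ← pow_add] at a2 a3
  norm_num at a2 a3
  calc qPoch (q ^ 2) (q ^ 2) ^ 2 = qPoch (q ^ 2) (q ^ 2) * (qPoch (q ^ 2) (q ^ 4) *
        qPoch (q ^ 4) (q ^ 4)) * (qPoch (-q ^ 2) (q ^ 2) * qPoch (q ^ 2) (q ^ 4)) := by
        rw [a2, ← a3]; ring
    _ = _ := by rw [← a1]; ring

/-- Serves both the third and the fourth quotient: the theta functions of 3τ stand on both sides,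
and what remains after cross-multiplying is this relation. -/
theorem qPoch_two_cube {q : ℂ} (hq : ‖q‖ < 1) :
    qPoch (q ^ 2) (q ^ 2) ^ 3 = qPoch q q ^ 2 * qPoch (-q ^ 2) (q ^ 2) *
      (qPoch (q ^ 4) (q ^ 4) * qPoch (-q) (q ^ 2) ^ 2) := by
  have h2 := norm_pow_lt_one hq two_ne_zero
  have a1 := qPoch_mul_qPoch_neg q hq
  have a2 := qPoch_split_two (-q) hq
  have a3 := qPoch_four_mul hq
  rw [neg_mul, ← sq] at a2
  calc qPoch (q ^ 2) (q ^ 2) ^ 3 = (qPoch q q * qPoch (-q) q) * (qPoch q q * qPoch (-q) q) *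
        qPoch (q ^ 2) (q ^ 2) := by rw [a1]; ring
    _ = qPoch q q ^ 2 * qPoch (-q) q * (qPoch (-q) q * qPoch (q ^ 2) (q ^ 2)) := by ring
    _ = _ := by rw [← a3, a2]; ring

end

/-! ### Assembly of the four identities -/

theorem mainTheorem6 (τ : ℍ) :
    -- first identity
    (IndefSummable latticeZZ (fun m n =>
        negOnePow (m + n) * qPow τ (2 * m * n + (m ^ 2 + m) / 2 + (n ^ 2 + n) / 2)) ∧
      qPow τ (1 / 12) * indefSum latticeZZ (fun m n =>
        negOnePow (m + n) * qPow τ (2 * m * n + (m ^ 2 + m) / 2 + (n ^ 2 + n) / 2)) =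
        ModularForm.eta (τ : ℂ) ^ 2) ∧
    -- second identity
    (IndefSummable latticeOdd (fun m n =>
        negOnePow ((m + n - 1) / 2) * qPow τ ((m ^ 2 + 6 * m * n + 3 * n ^ 2) / 2)) ∧
      thetaChar 0 (1 / 2) (4 * (τ : ℂ)) * thetaChar (1 / 2) (1 / 4) (τ : ℂ) ≠ 0 ∧
      (Multipliable fun n : ℕ+ =>
        (1 + qPow τ n) * (1 - qPow τ (2 * n)) * (1 - qPow τ (3 * n)) * (1 + qPow τ (6 * n))) ∧
      indefSum latticeOdd (fun m n =>
        negOnePow ((m + n - 1) / 2) * qPow τ ((m ^ 2 + 6 * m * n + 3 * n ^ 2) / 2)) =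
        ModularForm.eta (2 * (τ : ℂ)) ^ 3 * thetaChar (1 / 2) (1 / 4) (3 * (τ : ℂ)) /
          (thetaChar 0 (1 / 2) (4 * (τ : ℂ)) * thetaChar (1 / 2) (1 / 4) (τ : ℂ)) ∧
      ModularForm.eta (2 * (τ : ℂ)) ^ 3 * thetaChar (1 / 2) (1 / 4) (3 * (τ : ℂ)) /
          (thetaChar 0 (1 / 2) (4 * (τ : ℂ)) * thetaChar (1 / 2) (1 / 4) (τ : ℂ)) =
        qPow τ (1 / 2) * ∏' n : ℕ+,
          ((1 + qPow τ n) * (1 - qPow τ (2 * n)) * (1 - qPow τ (3 * n)) *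
            (1 + qPow τ (6 * n)))) ∧
    -- third identity
    (IndefSummable latticeHalfLeft (fun m n =>
        negOnePow (m + n - 1 / 2) * qPow τ ((m ^ 2 + 6 * m * n + 3 * n ^ 2) / 2)) ∧
      thetaChar (1 / 4) 0 (4 * (τ : ℂ)) * thetaChar 0 (1 / 4) (τ : ℂ) ≠ 0 ∧
      (Multipliable fun n : ℕ+ =>
        (1 - qPow τ n) * (1 + qPow τ (2 * n)) * (1 - qPow τ (3 * n)) *
          (1 + qPow τ (6 * n - 3))) ∧
      indefSum latticeHalfLeft (fun m n =>
        negOnePow (m + n - 1 / 2) * qPow τ ((m ^ 2 + 6 * m * n + 3 * n ^ 2) / 2)) =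
        ModularForm.eta (2 * (τ : ℂ)) ^ 3 * thetaChar 0 (1 / 4) (3 * (τ : ℂ)) /
          (thetaChar (1 / 4) 0 (4 * (τ : ℂ)) * thetaChar 0 (1 / 4) (τ : ℂ)) ∧
      ModularForm.eta (2 * (τ : ℂ)) ^ 3 * thetaChar 0 (1 / 4) (3 * (τ : ℂ)) /
          (thetaChar (1 / 4) 0 (4 * (τ : ℂ)) * thetaChar 0 (1 / 4) (τ : ℂ)) =
        qPow τ (1 / 8) * ∏' n : ℕ+,
          ((1 - qPow τ n) * (1 + qPow τ (2 * n)) * (1 - qPow τ (3 * n)) *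
            (1 + qPow τ (6 * n - 3)))) ∧
    -- fourth identity
    (IndefSummable latticeHalfRight (fun m n =>
        negOnePow (m + n - 1 / 2) * qPow τ ((m ^ 2 + 6 * m * n + 3 * n ^ 2) / 2)) ∧
      thetaChar (1 / 4) 0 (4 * (τ : ℂ)) * thetaChar (1 / 2) (1 / 4) (τ : ℂ) ≠ 0 ∧
      (Multipliable fun n : ℕ+ =>
        (1 - qPow τ n) * (1 + qPow τ (2 * n - 1)) * (1 - qPow τ (3 * n)) *
          (1 + qPow τ (6 * n))) ∧
      indefSum latticeHalfRight (fun m n =>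
        negOnePow (m + n - 1 / 2) * qPow τ ((m ^ 2 + 6 * m * n + 3 * n ^ 2) / 2)) =
        ModularForm.eta (2 * (τ : ℂ)) ^ 3 * thetaChar (1 / 2) (1 / 4) (3 * (τ : ℂ)) /
          (thetaChar (1 / 4) 0 (4 * (τ : ℂ)) * thetaChar (1 / 2) (1 / 4) (τ : ℂ)) ∧
      ModularForm.eta (2 * (τ : ℂ)) ^ 3 * thetaChar (1 / 2) (1 / 4) (3 * (τ : ℂ)) /
          (thetaChar (1 / 4) 0 (4 * (τ : ℂ)) * thetaChar (1 / 2) (1 / 4) (τ : ℂ)) =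
        qPow τ (3 / 8) * ∏' n : ℕ+,
          ((1 - qPow τ n) * (1 + qPow τ (2 * n - 1)) * (1 - qPow τ (3 * n)) *
            (1 + qPow τ (6 * n)))) := by
  have h0 := qPow_ne_zero τ 1
  have h1 := norm_qPow_one_lt τ
  have hne {a b : ℂ} (ha : ‖a‖ < 1) (hb : ‖b‖ < 1) : qPoch (-a) b ≠ 0 :=
    qPoch_ne_zero_of_norm_lt hb (by rwa [norm_neg])
  have hp {d : ℕ} (hd : d ≠ 0) := norm_pow_lt_one h1 hd
  have hE {a : ℂ} (ha : ‖a‖ < 1) : qPoch a a ≠ 0 := qPoch_ne_zero_of_norm_lt ha ha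
  have eta1 : ModularForm.eta (τ : ℂ) = qPow τ (1 / 24) * qPoch (qPow τ 1) (qPow τ 1) := by
    simpa using eta_natCast_mul τ (d := 1) (1 / 24) (by norm_num)
  have eta2 : ModularForm.eta (2 * (τ : ℂ)) =
      qPow τ (1 / 12) * qPoch (qPow τ 1 ^ 2) (qPow τ 1 ^ 2) := by
    simpa using eta_natCast_mul τ (d := 2) (1 / 12) (by norm_num)
  have theta1 : thetaChar (1 / 2) (1 / 4) (τ : ℂ) = cexp (π * I / 4) * (1 - I) * qPow τ (1 / 8) *
      (qPoch (qPow τ 1) (qPow τ 1) * qPoch (-qPow τ 1 ^ 2) (qPow τ 1 ^ 2)) := by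
    simpa using thetaChar_half_quarter_natCast_mul τ one_ne_zero (1 / 8) (by norm_num)
  have theta3 : thetaChar (1 / 2) (1 / 4) (3 * (τ : ℂ)) =
      cexp (π * I / 4) * (1 - I) * qPow τ (3 / 8) *
      (qPoch (qPow τ 1 ^ 3) (qPow τ 1 ^ 3) * qPoch (-qPow τ 1 ^ 6) (qPow τ 1 ^ 6)) := by
    simpa [← pow_mul] using thetaChar_half_quarter_natCast_mul τ three_ne_zero (3 / 8) (by norm_num)
  have vtheta1 : thetaChar 0 (1 / 4) (τ : ℂ) =
      qPoch (qPow τ 1) (qPow τ 1) * qPoch (-qPow τ 1) (qPow τ 1 ^ 2) := by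
    simpa using thetaChar_zero_quarter_natCast_mul τ one_ne_zero
  have vtheta3 : thetaChar 0 (1 / 4) (3 * (τ : ℂ)) =
      qPoch (qPow τ 1 ^ 3) (qPow τ 1 ^ 3) * qPoch (-qPow τ 1 ^ 3) (qPow τ 1 ^ 6) := by
    simpa [← pow_mul] using thetaChar_zero_quarter_natCast_mul τ three_ne_zero
  have theta4 := thetaChar_zero_half (t := (τ : ℂ)) τ.im_pos
  have wtheta4 := thetaChar_quarter_zero (t := (τ : ℂ)) τ.im_pos
  have e8 := exp_mul_eighth_eq_qPow τ 1 (1 / 8) (by norm_num)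
  rw [Nat.cast_one, one_mul] at e8
  rw [exp_eq_qPow_one] at theta4
  rw [exp_eq_qPow_one, e8] at wtheta4
  have nO : qPoch (qPow τ 1 ^ 2) (qPow τ 1 ^ 4) ≠ 0 :=
    qPoch_ne_zero_of_norm_lt (hp four_ne_zero) (hp two_ne_zero)
  have n1 : thetaChar (1 / 2) (1 / 4) (τ : ℂ) ≠ 0 := by
    rw [theta1]
    exact mul_ne_zero (mul_ne_zero one_sub_I_mul_exp_ne_zero (qPow_ne_zero _ _))
      (mul_ne_zero (hE h1) (hne (hp two_ne_zero) (hp two_ne_zero)))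
  have n2 : thetaChar 0 (1 / 4) (τ : ℂ) ≠ 0 := by
    rw [vtheta1]
    exact mul_ne_zero (hE h1) (hne h1 (hp two_ne_zero))
  have n3 : thetaChar 0 (1 / 2) (4 * (τ : ℂ)) ≠ 0 := by
    rw [theta4]
    exact mul_ne_zero (hE (hp four_ne_zero)) (pow_ne_zero 2 nO)
  have n4 : thetaChar (1 / 4) 0 (4 * (τ : ℂ)) ≠ 0 := by
    rw [wtheta4]
    exact mul_ne_zero (qPow_ne_zero _ _)
      (mul_ne_zero (hE (hp four_ne_zero)) (hne h1 (hp two_ne_zero)))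
  -- The q^(1/4) from η(2τ)³ is split so that one q^(1/8) matches a theta factor in the denominator.
  have q3 : qPow τ (1 / 12) ^ 3 = qPow τ (1 / 8) * qPow τ (1 / 8) := by
    rw [pow_succ, sq, ← qPow_add, ← qPow_add, ← qPow_add]
    norm_num
  have q2 : qPow τ (1 / 2) = qPow τ (1 / 8) * qPow τ (3 / 8) := by
    rw [← qPow_add]
    norm_num
  have quot2 : ModularForm.eta (2 * (τ : ℂ)) ^ 3 * thetaChar (1 / 2) (1 / 4) (3 * (τ : ℂ)) /
          (thetaChar 0 (1 / 2) (4 * (τ : ℂ)) * thetaChar (1 / 2) (1 / 4) (τ : ℂ)) =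
        qPow τ (1 / 2) * ∏' n : ℕ+,
          ((1 + qPow τ n) * (1 - qPow τ (2 * n)) * (1 - qPow τ (3 * n)) *
            (1 + qPow τ (6 * n))) := by
    rw [div_eq_iff (mul_ne_zero n3 n1), (hasProd_latticeOdd τ).tprod_eq, eta2, theta3, theta4,
      theta1, mul_pow, q3, q2]
    linear_combination (qPow τ (1 / 8) * qPow τ (1 / 8) * qPow τ (3 / 8) *
      qPoch (qPow τ 1 ^ 2) (qPow τ 1 ^ 2) * (cexp (π * I / 4) * (1 - I)) *
      (qPoch (qPow τ 1 ^ 3) (qPow τ 1 ^ 3) * qPoch (-qPow τ 1 ^ 6) (qPow τ 1 ^ 6))) *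
      qPoch_two_sq h1
  have quot3 : ModularForm.eta (2 * (τ : ℂ)) ^ 3 * thetaChar 0 (1 / 4) (3 * (τ : ℂ)) /
          (thetaChar (1 / 4) 0 (4 * (τ : ℂ)) * thetaChar 0 (1 / 4) (τ : ℂ)) =
        qPow τ (1 / 8) * ∏' n : ℕ+,
          ((1 - qPow τ n) * (1 + qPow τ (2 * n)) * (1 - qPow τ (3 * n)) *
            (1 + qPow τ (6 * n - 3))) := by
    rw [div_eq_iff (mul_ne_zero n4 n2), (hasProd_latticeHalfLeft τ).tprod_eq, eta2, vtheta3,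
      wtheta4, vtheta1, mul_pow, q3]
    linear_combination (qPow τ (1 / 8) * qPow τ (1 / 8) *
      (qPoch (qPow τ 1 ^ 3) (qPow τ 1 ^ 3) * qPoch (-qPow τ 1 ^ 3) (qPow τ 1 ^ 6))) *
      qPoch_two_cube h1
  have quot4 : ModularForm.eta (2 * (τ : ℂ)) ^ 3 * thetaChar (1 / 2) (1 / 4) (3 * (τ : ℂ)) /
          (thetaChar (1 / 4) 0 (4 * (τ : ℂ)) * thetaChar (1 / 2) (1 / 4) (τ : ℂ)) =
        qPow τ (3 / 8) * ∏' n : ℕ+,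
          ((1 - qPow τ n) * (1 + qPow τ (2 * n - 1)) * (1 - qPow τ (3 * n)) *
            (1 + qPow τ (6 * n))) := by
    rw [div_eq_iff (mul_ne_zero n4 n1), (hasProd_latticeHalfRight τ).tprod_eq, eta2, theta3,
      wtheta4, theta1, mul_pow, q3]
    linear_combination (qPow τ (1 / 8) * qPow τ (1 / 8) * qPow τ (3 / 8) *
      (cexp (π * I / 4) * (1 - I)) *
      (qPoch (qPow τ 1 ^ 3) (qPow τ 1 ^ 3) * qPoch (-qPow τ 1 ^ 6) (qPow τ 1 ^ 6))) *
      qPoch_two_cube h1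
  refine ⟨⟨(indefSum_latticeZZ τ).1, ?_⟩,
    ⟨(indefSum_latticeOdd τ).1, mul_ne_zero n3 n1, (hasProd_latticeOdd τ).multipliable, ?_, quot2⟩,
    ⟨(indefSum_latticeHalfLeft τ).1, mul_ne_zero n4 n2, (hasProd_latticeHalfLeft τ).multipliable,
      ?_, quot3⟩,
    ⟨(indefSum_latticeHalfRight τ).1, mul_ne_zero n4 n1, (hasProd_latticeHalfRight τ).multipliable,
      ?_, quot4⟩⟩
  · rw [(indefSum_latticeZZ τ).2, eta1, mul_pow, sq (qPow τ (1 / 24)), ← qPow_add]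
    norm_num
  · rw [quot2, (hasProd_latticeOdd τ).tprod_eq, (indefSum_latticeOdd τ).2,
      tsum_pow_sq_mul_sq h0 h1]
    linear_combination (qPow τ (1 / 2) * qPoch (qPow τ 1 ^ 3) (qPow τ 1 ^ 3) *
      qPoch (-qPow τ 1 ^ 6) (qPow τ 1 ^ 6)) * qPoch_four_mul h1
  · rw [quot3, (hasProd_latticeHalfLeft τ).tprod_eq, (indefSum_latticeHalfLeft τ).2,
      tsum_pow_sq_mul_self h0 h1]
    ring
  · rw [quot4, (hasProd_latticeHalfRight τ).tprod_eq, (indefSum_latticeHalfRight τ).2,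
      tsum_pow_sq_mul_sq h0 h1]
    ring
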